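/- Let $d_A,d\ge 1$ be integers. For $\psi=\sum_{i,j}M_{ij}|i\rangle|j\rangle\in\mathbb C^{d_A}\otimes\mathbb C^{d_A}$ write $\mathbb M(\psi)=M$, and let $\mathbb F(\psi)=\sum_{i,j}\overline{M_{ji}}\,|i\rangle|j\rangle$ be the flip (swap the factors and conjugate the coefficients), so that $\mathbb M(\mathbb F\psi)=\mathbb M(\psi)^\dagger$. For a subspace $S$, $\mathbb M(S)$ and $\mathbb F(S)$ denote images. Let $X$ be the $d_A\times d_A$ matrix with ones on its anti-diagonal and zeros elsewhere. Let $\mathrm{Gr}_d$ be the Grassmannian of $d$-dimensional complex subspaces of $\mathbb C^{d_A}\otimes\mathbb C^{d_A}$, and put $$F_d=\{S\in\mathrm{Gr}_d : \mathbb F(S)=S,\ \mathbb F((1\otimes X)S)=(1\otimes X)S\},\qquad C_d=\{S\in\mathrm{Gr}_d : S\perp\big((1+X)\otimes(1-X)\big)S^\perp\}.$$ Equip $\mathrm{Gr}_d$ with the unitarily invariant metric given by the Hilbert–Schmidt distance of orthogonal projectors, and equip $F_d\cap C_d$ with its normalised volume, i.e. the Hausdorff measure in the dimension $\dim(F_d\cap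 C_d)$, restricted to $F_d\cap C_d$ and divided by its total mass (which is positive and finite whenever $F_d\cap C_d$ is nonempty). Theorem. Let $d_A$ be even, $d\ge 1$ and $\lfloor d/2\rfloor\le d_A^2/2-2$. Then the set $P_d$ of all $S\in F_d\cap C_d$ for which there are nonzero positive semidefinite matrices $M\in\mathbb M(S)$ and $M'\in\mathbb M((1\otimes X)S^\perp)$ has nonzero measure in $F_d\cap C_d$. The same holds for the subset of $P_d$ of those $S$ for which $M$ and $M'$ can be chosen positive definite. -/

import Mathlib

namespace FlipSubspace

open scoped Kronecker ComplexOrder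

/-- The bipartite space `ℂⁿ ⊗ ℂⁿ` with its standard inner product: the vector `ψ` has the
coefficient `ψ (i, j)` at the product basis vector `|i⟩|j⟩`. -/
abbrev Bip (n : ℕ) : Type := EuclideanSpace ℂ (Fin n × Fin n)

/-- The matrix form of a bipartite vector: `ψ = ∑ i j, M i j |i⟩|j⟩` is sent to `M`. -/
def matForm (n : ℕ) : Bip n →ₗ[ℂ] Matrix (Fin n) (Fin n) ℂ where
  toFun ψ := Matrix.of fun i j => ψ (i, j)
  map_add' _ _ := rfl
  map_smul' _ _ := rfl

/-- The flip: swap the two tensor factors and take complex conjugates of the coefficients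
in the product basis. It is conjugate-linear. -/
def flip (n : ℕ) : Bip n →ₛₗ[starRingEnd ℂ] Bip n where
  toFun ψ := WithLp.toLp 2 fun p => starRingEnd ℂ (ψ (p.2, p.1))
  map_add' ψ φ := by ext p; simp
  map_smul' c ψ := by ext p; simp

/-- The matrix with ones on its anti-diagonal and zeros elsewhere. -/
def antiDiag (n : ℕ) : Matrix (Fin n) (Fin n) ℂ :=
  Matrix.of fun i j => if i = Fin.rev j then 1 else 0

/-- The operator `A ⊗ B` on `ℂⁿ ⊗ ℂⁿ`. -/
noncomputable def tensorOp {n : ℕ} (A B : Matrix (Fin n) (Fin n) ℂ) : Bip n →ₗ[ℂ] Bip n :=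
  Matrix.toEuclideanLin (A ⊗ₖ B)

/-- The Grassmannian of `d`-dimensional complex subspaces of `ℂⁿ ⊗ ℂⁿ`. -/
def Gr (d n : ℕ) : Type := {S : Submodule ℂ (Bip n) // Module.finrank ℂ S = d}

/-- The matrix entries of the orthogonal projector onto a subspace, as a point of a Euclidean
space, so that its norm is the Hilbert-Schmidt (Frobenius) norm of the projector. -/
noncomputable def projEntries {d n : ℕ} (S : Gr d n) :
    EuclideanSpace ℂ ((Fin n × Fin n) × (Fin n × Fin n)) :=
  WithLp.toLp 2 fun p => S.1.starProjection (EuclideanSpace.single p.2 1) p.1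

theorem projEntries_injective (d n : ℕ) :
    Function.Injective (projEntries : Gr d n → _) := by
  intro S T h
  have h1 : (S.1.starProjection : Bip n →ₗ[ℂ] Bip n) = T.1.starProjection := by
    refine (EuclideanSpace.basisFun (Fin n × Fin n) ℂ).toBasis.ext fun q => ?_
    ext p
    have := congrArg (fun v => v (p, q)) h
    simpa [projEntries] using this
  apply Subtype.ext
  have h2 : S.1.starProjection = T.1.starProjection := ContinuousLinearMap.coe_injective h1
  exact Submodule.starProjection_inj.mp h2

/-- The metric on the Grassmannian: the Hilbert-Schmidt distance of the orthogonal projectors.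
It is invariant under the unitary group, and its volume on the whole Grassmannian is, up to
normalisation, the measure induced by the Haar measure of the unitary group. -/
noncomputable instance (d n : ℕ) : MetricSpace (Gr d n) :=
  MetricSpace.induced projEntries (projEntries_injective d n) inferInstance

noncomputable instance (d n : ℕ) : MeasurableSpace (Gr d n) := borel _

instance (d n : ℕ) : BorelSpace (Gr d n) := ⟨rfl⟩

/-- The normalised volume on a subset `A` of a metric space: the Hausdorff measure whose
dimension is the dimension of `A`, restricted to `A` and divided by its total mass.
(If the total mass is `0` or `∞`, then every subset of `A` gets the value `0`.) -/
noncomputable def normalizedVolume {Y : Type*} [MetricSpace Y] [MeasurableSpace Y]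
    [BorelSpace Y] (A : Set Y) : MeasureTheory.Measure Y :=
  ProbabilityTheory.cond (MeasureTheory.Measure.hausdorffMeasure (dimH A).toReal) A

/-- The subspaces `S` with `𝔽(S) = S` and `𝔽((1 ⊗ X) S) = (1 ⊗ X) S`. -/
def F (d n : ℕ) : Set (Gr d n) :=
  {S | S.1.map (flip n) = S.1 ∧
    (S.1.map (tensorOp 1 (antiDiag n))).map (flip n) = S.1.map (tensorOp 1 (antiDiag n))}

/-- The subspaces `S` with `S ⊥ ((1 + X) ⊗ (1 - X)) S^⊥`. -/
def C (d n : ℕ) : Set (Gr d n) :=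
  {S | S.1 ⟂ S.1ᗮ.map (tensorOp (1 + antiDiag n) (1 - antiDiag n))}

/-- The elements `S` of `F ∩ C` for which the matrix spaces of `S` and of `(1 ⊗ X) S^⊥` both
contain a nonzero positive semidefinite matrix. -/
def P (d n : ℕ) : Set (Gr d n) :=
  {S | S ∈ F d n ∩ C d n ∧
    ∃ M ∈ S.1.map (matForm n), ∃ M' ∈ (S.1ᗮ.map (tensorOp 1 (antiDiag n))).map (matForm n),
      M ≠ 0 ∧ M' ≠ 0 ∧ M.PosSemidef ∧ M'.PosSemidef}

/-- The elements `S` of `F ∩ C` for which the matrix spaces of `S` and of `(1 ⊗ X) S^⊥` both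
contain a positive definite matrix. -/
def PDef (d n : ℕ) : Set (Gr d n) :=
  {S | S ∈ F d n ∩ C d n ∧
    ∃ M ∈ S.1.map (matForm n), ∃ M' ∈ (S.1ᗮ.map (tensorOp 1 (antiDiag n))).map (matForm n),
      M.PosDef ∧ M'.PosDef}

end FlipSubspace

/-! The operator defining `C` is four times the orthogonal projection `mixedProj`, so `F ∩ C`
consists of the subspaces invariant under the flip and under `mixedProj` (`mem_F_inter_C_iff`). Such
an `S` splits along three sectors: the `+1` eigenspace of `X ⊗ X`, of dimension `2e` with `e =
n²/4`, and two sectors of dimension `e` that the flip exchanges. If its parts have dimensions `k, m,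
m`, the first is the complexification of a real `k`-plane of flip-fixed vectors, the second is an
arbitrary complex `m`-plane, and the third is the flip of the second. Hence `F ∩ C` is a finite
union of pieces `Gr_k(ℝ^{2e}) × Gr_m(ℂ^e)` with `k + 2m = d`, of real dimension `k(2e - k) + 2m(e -
m)`.

Only pieces of the largest dimension carry volume. The bound on `d` forces `1 ≤ k ≤ 2e - 1` on such
a piece (`exists_optimal_dimensions`), which leaves room for an `S` on it that contains the identity
and is orthogonal to `X` (`exists_invariant`). For this `S` the identity serves as both matrices,
because `(1 ⊗ X)` sends `X` to `X² = 1`. Invariance keeps the projected matrices Hermitian, and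
positive definiteness is open among Hermitian matrices, so a whole neighbourhood of `S` in `F ∩ C`
lies in `PDef` (`exists_near_mem_PDef`).

Volumes are controlled by charts: graphs of tangent operators parametrise the invariant subspaces
near a given one, with Lipschitz estimates in both directions. They give finite total mass
(`hausdorffMeasure_invariant_lt_top`) and positive mass near `S` (`hausdorffMeasure_near_ne_zero`)
in the same dimension. -/

namespace FlipSubspace

/-! ### Graphs of tangent operators as charts of the Grassmannian. -/

section Shear

set_option linter.unusedSectionVars false

variable {V : Type*} [NormedAddCommGroup V] [InnerProductSpace ℂ V] [FiniteDimensional ℂ V]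

/-- The image of `S` under `1 + x`; for `x` tangent to `S` this is the graph of `x` over `S`. -/
def shear (S : Submodule ℂ V) (x : V →L[ℂ] V) : Submodule ℂ V :=
  S.map ((1 + x : V →L[ℂ] V) : V →ₗ[ℂ] V)

/-- The operators that map `S` into `Sᗮ` and vanish on `Sᗮ`. -/
def IsTangent (S : Submodule ℂ V) (x : V →L[ℂ] V) : Prop :=
  (∀ v, x v ∈ Sᗮ) ∧ ∀ v ∈ Sᗮ, x v = 0

variable {S T : Submodule ℂ V} {x y : V →L[ℂ] V}

theorem mem_shear {w : V} : w ∈ shear S x ↔ ∃ s ∈ S, s + x s = w := by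
  simp [shear]

theorem IsTangent.finrank_shear (hx : IsTangent S x) :
    Module.finrank ℂ (shear S x) = Module.finrank ℂ S := by
  have hinj : Function.Injective ((1 + x : V →L[ℂ] V) : V →ₗ[ℂ] V) := by
    refine (injective_iff_map_eq_zero _).2 fun v hv => ?_
    have h1 : v + x v = 0 := by simpa using hv
    have h2 : v = -(x v) := eq_neg_of_add_eq_zero_left h1
    have h3 : v ∈ Sᗮ := by rw [h2]; exact Sᗮ.neg_mem (hx.1 v)
    simpa [hx.2 v h3] using h1
  exact (Submodule.equivMapOfInjective _ hinj S).finrank_eq.symm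

theorem IsTangent.apply_starProjection (hx : IsTangent S x) (v : V) :
    x (S.starProjection v) = x v := by
  have h := hx.2 _ (S.sub_starProjection_mem_orthogonal v)
  rw [map_sub, sub_eq_zero] at h
  exact h.symm

theorem IsTangent.starProjection_apply (hx : IsTangent S x) {s : V} (hs : s ∈ S) :
    S.starProjection (s + x s) = s := by
  rw [map_add, Submodule.starProjection_eq_self_iff.2 hs,
    (Submodule.starProjection_apply_eq_zero_iff _).2 (hx.1 s), add_zero]

theorem IsTangent.eq_of_mem (hx : IsTangent S x) {w : V} (hw : w ∈ shear S x) :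
    w = S.starProjection w + x (S.starProjection w) := by
  obtain ⟨s, hs, rfl⟩ := mem_shear.1 hw
  rw [hx.starProjection_apply hs]

theorem IsTangent.norm_le (hx : IsTangent S x) {w : V} (hw : w ∈ shear S x) :
    ‖w‖ ≤ (1 + ‖x‖) * ‖S.starProjection w‖ := by
  conv_lhs => rw [hx.eq_of_mem hw]
  refine (norm_add_le _ _).trans ?_
  have := x.le_opNorm (S.starProjection w)
  linarith

theorem norm_sub_starProjection_le {δ : ℝ} (h : ∀ v ∈ S, ∃ w ∈ T, ‖v - w‖ ≤ δ * ‖v‖)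
    {v : V} (hv : v ∈ S) : ‖v - T.starProjection v‖ ≤ δ * ‖v‖ := by
  obtain ⟨w, hw, hvw⟩ := h v hv
  refine le_trans ?_ hvw
  rw [T.starProjection_minimal v]
  exact ciInf_le ⟨0, by rintro _ ⟨_, rfl⟩; exact norm_nonneg _⟩ (⟨w, hw⟩ : T)

/-- Split a vector along `S` and `Sᗮ`: closeness of `S` to `T` controls the first component, and
closeness of `T` to `S` controls, by duality, the projection of the second one to `T`. -/
theorem norm_starProjection_sub_le {δ : ℝ} (hδ : 0 ≤ δ)
    (h1 : ∀ v ∈ S, ∃ w ∈ T, ‖v - w‖ ≤ δ * ‖v‖) (h2 : ∀ v ∈ T, ∃ w ∈ S, ‖v - w‖ ≤ δ * ‖v‖) :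
    ‖S.starProjection - T.starProjection‖ ≤ 2 * δ := by
  refine ContinuousLinearMap.opNorm_le_bound _ (by positivity) fun u => ?_
  set z := u - S.starProjection u with hz
  have hzS : z ∈ Sᗮ := S.sub_starProjection_mem_orthogonal u
  have hzu : ‖z‖ ≤ ‖u‖ := by
    have := Submodule.norm_starProjection_apply_le Sᗮ u
    rwa [Submodule.starProjection_orthogonal_val] at this
  have e : (S.starProjection - T.starProjection) u =
      (S.starProjection u - T.starProjection (S.starProjection u)) - T.starProjection z := by
    simp [hz]
  have b1 : ‖S.starProjection u - T.starProjection (S.starProjection u)‖ ≤ δ * ‖u‖ :=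
    (norm_sub_starProjection_le h1 (S.starProjection_apply_mem u)).trans
      (by gcongr; exact S.norm_starProjection_apply_le u)
  -- With `q` the projection of `z` to `T`, `⟨q, q⟩ = ⟨q, z⟩ = ⟨q - P_S q, z⟩` since `z ⊥ S`;
  -- Cauchy–Schwarz then gains the factor `δ`.
  have b2 : ‖T.starProjection z‖ ≤ δ * ‖z‖ := by
    set q := T.starProjection z with hq
    have hqT : q ∈ T := T.starProjection_apply_mem z
    have i1 : inner ℂ q q = inner ℂ (q - S.starProjection q) z := by
      rw [inner_sub_left, Submodule.inner_right_of_mem_orthogonal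
        (S.starProjection_apply_mem q) hzS, sub_zero]
      have := Submodule.starProjection_inner_eq_zero (K := T) z q hqT
      rw [inner_sub_left, sub_eq_zero] at this
      rw [← inner_conj_symm q z, this, hq, inner_conj_symm]
    have i2 : ‖q‖ * ‖q‖ ≤ (δ * ‖z‖) * ‖q‖ := by
      have : ‖inner ℂ q q‖ = ‖q‖ * ‖q‖ := by
        rw [inner_self_eq_norm_mul_norm (𝕜 := ℂ) q |>.symm, inner_self_eq_norm_sq_to_K]
        simp [pow_two]
      rw [← this, i1]
      refine (norm_inner_le_norm _ _).trans ?_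
      have := norm_sub_starProjection_le h2 hqT
      nlinarith [norm_nonneg z]
    rcases (norm_nonneg q).eq_or_lt with h0 | h0
    · rw [← h0]; positivity
    · exact le_of_mul_le_mul_right i2 h0
  rw [e]
  refine (norm_sub_le _ _).trans ?_
  nlinarith

theorem IsTangent.exists_near (hx : IsTangent S x) (y : V →L[ℂ] V) {v : V}
    (hv : v ∈ shear S x) : ∃ w ∈ shear S y, ‖v - w‖ ≤ ‖x - y‖ * ‖v‖ := by
  obtain ⟨s, hs, rfl⟩ := mem_shear.1 hv
  refine ⟨_, mem_shear.2 ⟨s, hs, rfl⟩, ?_⟩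
  have e : s + x s - (s + y s) = (x - y) s := by simp
  have h := S.norm_starProjection_apply_le (s + x s)
  rw [hx.starProjection_apply hs] at h
  rw [e]
  exact ((x - y).le_opNorm s).trans (by gcongr)

/-- The projector onto the graph of `x` depends on `x` in a Lipschitz way. -/
theorem IsTangent.norm_starProjection_shear_sub_le (hx : IsTangent S x) (hy : IsTangent S y) :
    ‖(shear S x).starProjection - (shear S y).starProjection‖ ≤ 2 * ‖x - y‖ :=
  norm_starProjection_sub_le (norm_nonneg _) (fun _ hv => hx.exists_near y hv)
    fun v hv => by simpa [norm_sub_rev x y] using hy.exists_near x hv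

/-- The operator `x` depends on the projector onto its graph in a locally Lipschitz way. -/
theorem IsTangent.norm_sub_le (hx : IsTangent S x) (hy : IsTangent S y) :
    ‖x - y‖ ≤ (2 + ‖y‖) * (1 + ‖x‖) *
      ‖(shear S x).starProjection - (shear S y).starProjection‖ := by
  refine ContinuousLinearMap.opNorm_le_bound _ (by positivity) fun u => ?_
  set s := S.starProjection u with hs
  have hsS : s ∈ S := S.starProjection_apply_mem u
  set P := (shear S x).starProjection with hP
  set Q := (shear S y).starProjection with hQ
  set v := s + x s with hv
  set w := s + y s with hw
  have hvm : v ∈ shear S x := mem_shear.2 ⟨s, hsS, rfl⟩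
  have hwm : w ∈ shear S y := mem_shear.2 ⟨s, hsS, rfl⟩
  have hPv : P v = v := Submodule.starProjection_eq_self_iff.2 hvm
  have e1 : (x - y) u = v - w := by
    rw [sub_apply, ← hx.apply_starProjection, ← hy.apply_starProjection, hv, hw]
    abel
  have b1 : ‖v - Q v‖ ≤ ‖P - Q‖ * ‖v‖ := by
    have := (P - Q).le_opNorm v
    rwa [sub_apply, hPv] at this
  -- A vector of the graph of `y` is controlled by its `S`-component. Since `v` and `w` share the
  -- component `s`, that of `Q v - w` is minus that of `v - Q v`.
  have hum : Q v - w ∈ shear S y := (shear S y).sub_mem (Submodule.starProjection_apply_mem _ _) hwm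
  have b2 := hy.norm_le hum
  have e2 : S.starProjection (Q v - w) = -S.starProjection (v - Q v) := by
    rw [map_sub, map_sub, hw, hv, hx.starProjection_apply hsS, hy.starProjection_apply hsS]
    abel
  rw [e2, norm_neg] at b2
  have b3 : ‖Q v - w‖ ≤ (1 + ‖y‖) * (‖P - Q‖ * ‖v‖) :=
    b2.trans (by gcongr; exact (S.norm_starProjection_apply_le _).trans b1)
  have b4 : ‖v‖ ≤ (1 + ‖x‖) * ‖u‖ := by
    have := hx.norm_le hvm
    rw [hx.starProjection_apply hsS] at this
    exact this.trans (by gcongr; exact S.norm_starProjection_apply_le u)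
  rw [e1]
  calc ‖v - w‖ = ‖(v - Q v) + (Q v - w)‖ := by congr 1; abel
    _ ≤ ‖P - Q‖ * ‖v‖ + (1 + ‖y‖) * (‖P - Q‖ * ‖v‖) := (norm_add_le _ _).trans (add_le_add b1 b3)
    _ = (2 + ‖y‖) * ‖P - Q‖ * ‖v‖ := by ring
    _ ≤ (2 + ‖y‖) * ‖P - Q‖ * ((1 + ‖x‖) * ‖u‖) := by gcongr
    _ = _ := by ring

/-- Every subspace close to `S` is the graph of a tangent operator. -/
theorem exists_shear_eq (hST : Module.finrank ℂ T = Module.finrank ℂ S)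
    (h : ‖T.starProjection - S.starProjection‖ ≤ 1 / 2) :
    ∃ x : V →L[ℂ] V, IsTangent S x ∧ ‖x‖ ≤ 2 ∧ T = shear S x := by
  have hlow : ∀ v ∈ T, ‖v‖ ≤ 2 * ‖S.starProjection v‖ := by
    intro v hv
    have h1 := (T.starProjection - S.starProjection).le_opNorm v
    rw [sub_apply, Submodule.starProjection_eq_self_iff.2 hv] at h1
    have h2 := norm_sub_norm_le v (S.starProjection v)
    nlinarith [norm_nonneg v]
  -- By `hlow` the projection `T → S` is injective, hence bijective by equality of dimensions; `x0`
  -- is the `Sᗮ`-component of its inverse.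
  let f : T →ₗ[ℂ] S := (S.orthogonalProjectionOnto : V →ₗ[ℂ] S) ∘ₗ T.subtype
  have hf : ∀ t : T, (f t : V) = S.starProjection t := fun t => rfl
  have hinj : Function.Injective f := by
    refine (injective_iff_map_eq_zero _).2 fun t ht => ?_
    have h1 := hlow t t.2
    rw [← hf, ht] at h1
    have h2 : ‖(t : V)‖ ≤ 0 := by simpa using h1
    exact Subtype.ext (norm_le_zero_iff.1 h2)
  let g := LinearEquiv.ofInjectiveOfFinrankEq f hinj hST
  have hg : ∀ t, g t = f t := fun t => rfl
  have hgs : ∀ s : S, S.starProjection (g.symm s : V) = s := fun s => by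
    rw [← hf, ← hg, LinearEquiv.apply_symm_apply]
  let x0 : V →ₗ[ℂ] V := (LinearMap.id - (S.starProjection : V →ₗ[ℂ] V)) ∘ₗ T.subtype ∘ₗ
    (g.symm : S →ₗ[ℂ] T) ∘ₗ (S.orthogonalProjectionOnto : V →ₗ[ℂ] S)
  have hx0 : ∀ v, x0 v = (g.symm (S.orthogonalProjectionOnto v) : V) -
      S.starProjection (g.symm (S.orthogonalProjectionOnto v) : V) := fun v => rfl
  have hx0' : ∀ s : S, (s : V) + x0 s = g.symm s := fun s => by
    rw [hx0, hgs, Submodule.orthogonalProjectionOnto_mem_subspace_eq_self]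
    abel
  refine ⟨LinearMap.toContinuousLinearMap x0, ⟨fun v => ?_, fun v hv => ?_⟩, ?_, ?_⟩
  · exact S.sub_starProjection_mem_orthogonal _
  · change x0 v = 0
    rw [hx0, Submodule.orthogonalProjectionOnto_apply_of_mem_orthogonal hv]
    simp
  · refine ContinuousLinearMap.opNorm_le_bound _ (by norm_num) fun v => ?_
    change ‖x0 v‖ ≤ _
    rw [hx0, ← Submodule.starProjection_orthogonal_val]
    refine (Submodule.norm_starProjection_apply_le _ _).trans ((hlow _ (g.symm _).2).trans ?_)
    rw [hgs]
    gcongr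
    exact S.norm_starProjection_apply_le v
  · ext w
    rw [mem_shear]
    constructor
    · intro hw
      refine ⟨f ⟨w, hw⟩, (f ⟨w, hw⟩).2, ?_⟩
      change (f ⟨w, hw⟩ : V) + x0 _ = w
      rw [hx0', ← hg, LinearEquiv.symm_apply_apply]
    · rintro ⟨s, hs, rfl⟩
      change s + x0 s ∈ T
      rw [hx0' ⟨s, hs⟩]
      exact (g.symm _).2

/-- A point of a graph is determined by its `S`-component, and `f (s + x s)` is the graph point over
`f s`. Additivity of `f` suffices, so the conjugate-linear flip is covered too. -/
theorem IsTangent.comm_of_mapsTo (hx : IsTangent S x) {f : V →+ V} (hS : ∀ v ∈ S, f v ∈ S)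
    (hS' : ∀ v ∈ Sᗮ, f v ∈ Sᗮ) (hT : ∀ v ∈ shear S x, f v ∈ shear S x) (v : V) :
    x (f v) = f (x v) := by
  have key : ∀ s ∈ S, x (f s) = f (x s) := by
    intro s hs
    have h1 := hT _ (mem_shear.2 ⟨s, hs, rfl⟩)
    have h2 := hx.eq_of_mem h1
    have h3 : S.starProjection (f (s + x s)) = f s := by
      rw [map_add, map_add, Submodule.starProjection_eq_self_iff.2 (hS s hs),
        (Submodule.starProjection_apply_eq_zero_iff _).2 (hS' _ (hx.1 s)), add_zero]
    rw [h3, map_add] at h2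
    exact (add_left_cancel h2).symm
  have h0 := S.sub_starProjection_mem_orthogonal v
  have h4 : f v = f (S.starProjection v) + f (v - S.starProjection v) := by
    rw [← map_add]; congr 1; abel
  rw [h4, map_add, hx.2 _ (hS' _ h0), add_zero, key _ (S.starProjection_apply_mem v),
    hx.apply_starProjection]

theorem starProjection_comm_of_mapsTo {f : V →+ V} (hS : ∀ v ∈ S, f v ∈ S)
    (hS' : ∀ v ∈ Sᗮ, f v ∈ Sᗮ) (v : V) : S.starProjection (f v) = f (S.starProjection v) := by
  refine Submodule.eq_starProjection_of_mem_orthogonal (hS _ (S.starProjection_apply_mem v)) ?_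
  rw [← map_sub]
  exact hS' _ (S.sub_starProjection_mem_orthogonal v)

end Shear

end FlipSubspace

/-! ### The flip, the mixed projections, and `F ∩ C` as a set of invariant subspaces. -/

namespace FlipSubspace

open scoped Kronecker ComplexOrder Matrix

variable {n : ℕ}

theorem antiDiag_transpose : (antiDiag n)ᵀ = antiDiag n := by
  ext i j
  simp only [antiDiag, Matrix.transpose_apply, Matrix.of_apply]
  congr 1
  rw [eq_iff_iff]
  constructor <;> rintro rfl <;> simp

theorem antiDiag_conjTranspose : (antiDiag n)ᴴ = antiDiag n := by
  rw [Matrix.conjTranspose, antiDiag_transpose]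
  ext i j
  simp only [antiDiag, Matrix.map_apply, Matrix.of_apply]
  split_ifs <;> simp

theorem antiDiag_mul_self : antiDiag n * antiDiag n = 1 := by
  ext i j
  simp only [antiDiag, Matrix.mul_apply, Matrix.of_apply, Matrix.one_apply]
  simp

theorem antiDiag_trace (hn : Even n) : (antiDiag n).trace = 0 := by
  refine Finset.sum_eq_zero fun i _ => ?_
  simp only [antiDiag, Matrix.diag_apply, Matrix.of_apply]
  rw [if_neg]
  intro h
  have := congrArg Fin.val h
  rw [Fin.val_rev] at this
  obtain ⟨r, hr⟩ := hn
  omega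

theorem matForm_apply (v : Bip n) (i j : Fin n) : matForm n v i j = v (i, j) := rfl

theorem matForm_injective : Function.Injective (matForm n) := by
  intro v w h
  ext ⟨i, j⟩
  rw [← matForm_apply, h, matForm_apply]

/-- The bipartite vector with a given coefficient matrix. -/
def ofMat (M : Matrix (Fin n) (Fin n) ℂ) : Bip n := WithLp.toLp 2 fun p => M p.1 p.2

@[simp]
theorem matForm_ofMat (M : Matrix (Fin n) (Fin n) ℂ) : matForm n (ofMat M) = M := rfl

@[simp]
theorem matForm_flip (v : Bip n) : matForm n (flip n v) = (matForm n v)ᴴ := rfl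

theorem matForm_tensorOp (A B : Matrix (Fin n) (Fin n) ℂ) (v : Bip n) :
    matForm n (tensorOp A B v) = A * matForm n v * Bᵀ := by
  ext i j
  rw [matForm_apply]
  simp only [tensorOp, Matrix.toLpLin_apply, Matrix.mulVec, dotProduct, Matrix.kroneckerMap_apply,
    Matrix.mul_apply, Matrix.transpose_apply, matForm_apply, Fintype.sum_prod_type, Finset.sum_mul]
  rw [Finset.sum_comm]
  refine Finset.sum_congr rfl fun b _ => Finset.sum_congr rfl fun a _ => ?_
  ring

theorem inner_eq_trace (v w : Bip n) :
    inner ℂ v w = ((matForm n v)ᴴ * matForm n w).trace := by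
  simp only [PiLp.inner_apply, Matrix.trace, Matrix.diag_apply, Matrix.mul_apply,
    Matrix.conjTranspose_apply, matForm_apply, Fintype.sum_prod_type]
  rw [Finset.sum_comm]
  refine Finset.sum_congr rfl fun b _ => Finset.sum_congr rfl fun a _ => ?_
  simp [mul_comm]

@[simp]
theorem flip_flip (v : Bip n) : flip n (flip n v) = v :=
  matForm_injective (by simp)

theorem inner_flip_flip (v w : Bip n) : inner ℂ (flip n v) (flip n w) = inner ℂ w v := by
  rw [inner_eq_trace, inner_eq_trace, matForm_flip, matForm_flip, Matrix.conjTranspose_conjTranspose,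
    Matrix.trace_mul_comm]

theorem inner_flip (v w : Bip n) : inner ℂ (flip n v) w = inner ℂ (flip n w) v := by
  rw [← inner_flip_flip, flip_flip]

/-- The orthogonal projection onto `ran (1 + X) ⊗ ran (1 - X)`. -/
noncomputable def mixedProj (n : ℕ) : Bip n →ₗ[ℂ] Bip n :=
  (1 / 4 : ℂ) • tensorOp (1 + antiDiag n) (1 - antiDiag n)

/-- The orthogonal projection onto `ran (1 - X) ⊗ ran (1 + X)`. -/
noncomputable def mixedProj' (n : ℕ) : Bip n →ₗ[ℂ] Bip n :=
  (1 / 4 : ℂ) • tensorOp (1 - antiDiag n) (1 + antiDiag n)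

theorem matForm_mixedProj (v : Bip n) : matForm n (mixedProj n v) =
    (1 / 4 : ℂ) • ((1 + antiDiag n) * matForm n v * (1 - antiDiag n)) := by
  rw [mixedProj, LinearMap.smul_apply, map_smul, matForm_tensorOp, Matrix.transpose_sub,
    antiDiag_transpose, Matrix.transpose_one]

theorem matForm_mixedProj' (v : Bip n) : matForm n (mixedProj' n v) =
    (1 / 4 : ℂ) • ((1 - antiDiag n) * matForm n v * (1 + antiDiag n)) := by
  rw [mixedProj', LinearMap.smul_apply, map_smul, matForm_tensorOp, Matrix.transpose_add,
    antiDiag_transpose, Matrix.transpose_one]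

theorem flip_mixedProj (v : Bip n) : flip n (mixedProj n v) = mixedProj' n (flip n v) := by
  refine matForm_injective ?_
  rw [matForm_flip, matForm_mixedProj, matForm_mixedProj', matForm_flip]
  simp [antiDiag_conjTranspose, Matrix.mul_assoc]

theorem flip_mixedProj' (v : Bip n) : flip n (mixedProj' n v) = mixedProj n (flip n v) := by
  rw [← flip_flip (mixedProj n _), flip_mixedProj, flip_flip]

theorem one_add_antiDiag_mul_self :
    (1 + antiDiag n) * (1 + antiDiag n) = (2 : ℂ) • (1 + antiDiag n) := by
  rw [mul_add, add_mul, add_mul, antiDiag_mul_self]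
  simp only [one_mul, mul_one]
  module

theorem one_sub_antiDiag_mul_self :
    (1 - antiDiag n) * (1 - antiDiag n) = (2 : ℂ) • (1 - antiDiag n) := by
  rw [mul_sub, sub_mul, sub_mul, antiDiag_mul_self]
  simp only [one_mul, mul_one]
  module

theorem one_add_mul_one_sub_antiDiag : (1 + antiDiag n) * (1 - antiDiag n) = 0 := by
  rw [mul_sub, add_mul, add_mul, antiDiag_mul_self]
  simp only [one_mul, mul_one]
  module

theorem one_sub_mul_one_add_antiDiag : (1 - antiDiag n) * (1 + antiDiag n) = 0 := by
  rw [mul_add, sub_mul, sub_mul, antiDiag_mul_self]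
  simp only [one_mul, mul_one]
  module

theorem tensorOp_mul (A B A' B' : Matrix (Fin n) (Fin n) ℂ) :
    tensorOp A B * tensorOp A' B' = tensorOp (A * A') (B * B') := by
  ext1 v
  refine matForm_injective ?_
  rw [Module.End.mul_apply, matForm_tensorOp, matForm_tensorOp, matForm_tensorOp,
    Matrix.transpose_mul]
  simp only [Matrix.mul_assoc]

theorem tensorOp_smul (a b : ℂ) (A B : Matrix (Fin n) (Fin n) ℂ) :
    tensorOp (a • A) (b • B) = (a * b) • tensorOp A B := by
  ext1 v
  refine matForm_injective ?_
  rw [LinearMap.smul_apply, map_smul, matForm_tensorOp, matForm_tensorOp, Matrix.transpose_smul]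
  simp [smul_smul, mul_comm]

theorem mixedProj_mul_self : mixedProj n * mixedProj n = mixedProj n := by
  rw [mixedProj, smul_mul_smul_comm, tensorOp_mul, one_add_antiDiag_mul_self,
    one_sub_antiDiag_mul_self, tensorOp_smul, smul_smul]
  norm_num

theorem mixedProj'_mul_self : mixedProj' n * mixedProj' n = mixedProj' n := by
  rw [mixedProj', smul_mul_smul_comm, tensorOp_mul, one_add_antiDiag_mul_self,
    one_sub_antiDiag_mul_self, tensorOp_smul, smul_smul]
  norm_num

theorem tensorOp_zero_left (B : Matrix (Fin n) (Fin n) ℂ) : tensorOp 0 B = 0 := by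
  simp [tensorOp]

theorem mixedProj_mul_mixedProj' : mixedProj n * mixedProj' n = 0 := by
  rw [mixedProj, mixedProj', smul_mul_smul_comm, tensorOp_mul, one_add_mul_one_sub_antiDiag,
    tensorOp_zero_left, smul_zero]

theorem mixedProj'_mul_mixedProj : mixedProj' n * mixedProj n = 0 := by
  rw [mixedProj, mixedProj', smul_mul_smul_comm, tensorOp_mul, one_sub_mul_one_add_antiDiag,
    tensorOp_zero_left, smul_zero]

theorem inner_tensorOp (A B : Matrix (Fin n) (Fin n) ℂ) (v w : Bip n) :
    inner ℂ (tensorOp A B v) w = inner ℂ v (tensorOp Aᴴ Bᴴ w) := by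
  rw [inner_eq_trace, inner_eq_trace, matForm_tensorOp, matForm_tensorOp]
  simp only [Matrix.conjTranspose_mul, ← Matrix.mul_assoc]
  rw [Matrix.mul_assoc, Matrix.mul_assoc, Matrix.trace_mul_comm]
  simp only [Matrix.conjTranspose, Matrix.transpose_map, Matrix.transpose_transpose,
    Matrix.mul_assoc]

theorem inner_mixedProj (v w : Bip n) :
    inner ℂ (mixedProj n v) w = inner ℂ v (mixedProj n w) := by
  rw [mixedProj, LinearMap.smul_apply, LinearMap.smul_apply, inner_smul_left, inner_smul_right,
    inner_tensorOp]
  simp [antiDiag_conjTranspose, map_ofNat (starRingEnd ℂ) 4]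

theorem inner_mixedProj' (v w : Bip n) :
    inner ℂ (mixedProj' n v) w = inner ℂ v (mixedProj' n w) := by
  rw [mixedProj', LinearMap.smul_apply, LinearMap.smul_apply, inner_smul_left, inner_smul_right,
    inner_tensorOp]
  simp [antiDiag_conjTranspose, map_ofNat (starRingEnd ℂ) 4]

/-- The ranges of the two mixed projections span the `-1` eigenspace of the involution `X ⊗ X`. -/
theorem tensorOp_antiDiag_antiDiag (v : Bip n) :
    tensorOp (antiDiag n) (antiDiag n) v =
      v - (2 : ℂ) • mixedProj n v - (2 : ℂ) • mixedProj' n v := by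
  refine matForm_injective ?_
  rw [map_sub, map_sub, map_smul, map_smul, matForm_mixedProj, matForm_mixedProj',
    matForm_tensorOp, antiDiag_transpose]
  simp only [add_mul, sub_mul, mul_add, mul_sub, one_mul, mul_one]
  module

/-- Invariance of a subspace under the flip and under the projection `mixedProj`. -/
def IsInvariant (S : Submodule ℂ (Bip n)) : Prop :=
  (∀ v ∈ S, flip n v ∈ S) ∧ ∀ v ∈ S, mixedProj n v ∈ S

theorem IsInvariant.mixedProj'_mem {S : Submodule ℂ (Bip n)} (hS : IsInvariant S) {v : Bip n}
    (hv : v ∈ S) : mixedProj' n v ∈ S := by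
  rw [← flip_flip (mixedProj' n v), flip_mixedProj']
  exact hS.1 _ (hS.2 _ (hS.1 _ hv))

theorem IsInvariant.orthogonal {S : Submodule ℂ (Bip n)} (hS : IsInvariant S) :
    IsInvariant Sᗮ := by
  refine ⟨fun v hv => ?_, fun v hv => ?_⟩
  · rw [Submodule.mem_orthogonal'] at hv ⊢
    intro u hu
    rw [inner_flip, ← inner_conj_symm, hv _ (hS.1 u hu), map_zero]
  · rw [Submodule.mem_orthogonal'] at hv ⊢
    intro u hu
    rw [inner_mixedProj, hv _ (hS.2 u hu)]

theorem map_flip_eq_iff {S : Submodule ℂ (Bip n)} :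
    S.map (flip n) = S ↔ ∀ v ∈ S, flip n v ∈ S := by
  constructor
  · intro h v hv
    rw [← h]
    exact Submodule.mem_map_of_mem hv
  · intro h
    refine le_antisymm (Submodule.map_le_iff_le_comap.2 h) fun v hv => ?_
    exact ⟨flip n v, h v hv, flip_flip v⟩

theorem tensorOp_flip_tensorOp (v : Bip n) :
    tensorOp 1 (antiDiag n) (flip n (tensorOp 1 (antiDiag n) v)) =
      tensorOp (antiDiag n) (antiDiag n) (flip n v) := by
  refine matForm_injective ?_
  simp only [matForm_tensorOp, matForm_flip, one_mul, Matrix.conjTranspose_mul, antiDiag_transpose,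
    antiDiag_conjTranspose]

theorem tensorOp_one_antiDiag_self (v : Bip n) :
    tensorOp 1 (antiDiag n) (tensorOp 1 (antiDiag n) v) = v := by
  refine matForm_injective ?_
  simp only [matForm_tensorOp, one_mul, antiDiag_transpose, Matrix.mul_assoc, antiDiag_mul_self,
    mul_one]

/-- Self-adjointness moves `mixedProj` to the other side of the inner product, so the condition
reads `mixedProj S ⊥ Sᗮ`. -/
theorem mem_C_iff {d : ℕ} {S : Gr d n} : S ∈ C d n ↔ ∀ v ∈ S.1, mixedProj n v ∈ S.1 := by
  have h4 : ∀ v : Bip n, tensorOp (1 + antiDiag n) (1 - antiDiag n) v =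
      (4 : ℂ) • mixedProj n v := fun v => by
    rw [mixedProj, LinearMap.smul_apply, smul_smul]; norm_num
  rw [C, Set.mem_ofPred_eq, Submodule.isOrtho_iff_inner_eq]
  constructor
  · intro h v hv
    rw [← Submodule.orthogonal_orthogonal S.1, Submodule.mem_orthogonal']
    intro t ht
    have := h v hv _ (Submodule.mem_map_of_mem ht)
    rw [h4, inner_smul_right, ← inner_mixedProj] at this
    simpa using this
  · rintro h v hv _ ⟨t, ht, rfl⟩
    rw [h4, inner_smul_right, ← inner_mixedProj,
      (Submodule.mem_orthogonal S.1 t).1 ht _ (h v hv), mul_zero]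

/-- Conjugating the flip by `1 ⊗ X` composes it with `X ⊗ X`, a combination of the identity and the
mixed projections; so the second flip condition follows from invariance. -/
theorem mem_F_inter_C_iff {d : ℕ} {S : Gr d n} : S ∈ F d n ∩ C d n ↔ IsInvariant S.1 := by
  rw [Set.mem_inter_iff, mem_C_iff]
  constructor
  · rintro ⟨⟨h1, -⟩, h3⟩
    exact ⟨map_flip_eq_iff.1 h1, h3⟩
  · intro h
    refine ⟨⟨map_flip_eq_iff.2 h.1, map_flip_eq_iff.2 ?_⟩, h.2⟩
    rintro _ ⟨v, hv, rfl⟩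
    refine ⟨tensorOp (antiDiag n) (antiDiag n) (flip n v), ?_, ?_⟩
    · have hf := h.1 v hv
      rw [tensorOp_antiDiag_antiDiag]
      exact S.1.sub_mem (S.1.sub_mem hf (S.1.smul_mem _ (h.2 _ hf)))
        (S.1.smul_mem _ (h.mixedProj'_mem hf))
    · rw [← tensorOp_flip_tensorOp, tensorOp_one_antiDiag_self]

end FlipSubspace

/-! ### Dimension counts: real forms, Peirce corners, traces. -/

namespace FlipSubspace

open scoped Kronecker ComplexOrder Matrix

section FixedPoints

variable {A : Type*} [AddCommGroup A] [Module ℂ A] [Module ℝ A] [IsScalarTower ℝ ℂ A]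

/-- The real subspace of the elements of `W` that are fixed by the conjugate-linear map `τ`. -/
def fixedIn (τ : A →ₛₗ[starRingEnd ℂ] A) (W : Submodule ℂ A) : Submodule ℝ A where
  carrier := {x | x ∈ W ∧ τ x = x}
  add_mem' hx hy := ⟨W.add_mem hx.1 hy.1, by rw [map_add, hx.2, hy.2]⟩
  zero_mem' := ⟨W.zero_mem, map_zero τ⟩
  smul_mem' r x hx := by
    have h : r • x = (r : ℂ) • x := (algebraMap_smul ℂ r x).symm
    refine ⟨?_, ?_⟩
    · rw [h]; exact W.smul_mem _ hx.1
    · rw [h, LinearMap.map_smulₛₗ, hx.2, Complex.conj_ofReal]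

theorem mem_fixedIn {τ : A →ₛₗ[starRingEnd ℂ] A} {W : Submodule ℂ A} {x : A} :
    x ∈ fixedIn τ W ↔ x ∈ W ∧ τ x = x := Iff.rfl

/-- The fixed points of a conjugate-linear involution form a real form. -/
theorem finrank_fixedIn [FiniteDimensional ℂ A] {τ : A →ₛₗ[starRingEnd ℂ] A}
    (hτ : ∀ x, τ (τ x) = x) {W : Submodule ℂ A} (hW : ∀ x ∈ W, τ x ∈ W) :
    Module.finrank ℝ (fixedIn τ W) = Module.finrank ℂ W := by
  have hr : ∀ (r : ℝ) (x : A), r • x = (r : ℂ) • x := fun r x => (algebraMap_smul ℂ r x).symm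
  have : FiniteDimensional ℝ A := Module.Finite.trans ℂ A
  -- The decomposition `W = W^τ ⊕ i W^τ` into real and imaginary parts for `τ`.
  let f : fixedIn τ W × fixedIn τ W →ₗ[ℝ] W :=
    { toFun := fun z => ⟨z.1 + Complex.I • (z.2 : A), W.add_mem z.1.2.1 (W.smul_mem _ z.2.2.1)⟩
      map_add' := fun z w => by ext1; simp; abel
      map_smul' := fun r z => by
        ext1
        change r • (z.1 : A) + Complex.I • r • (z.2 : A) = r • ((z.1 : A) + Complex.I • (z.2 : A))
        rw [hr, hr, hr, smul_add, smul_comm Complex.I] }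
  have hf : ∀ z, (f z : A) = z.1 + Complex.I • (z.2 : A) := fun z => rfl
  have htf : ∀ z, τ (f z : A) = z.1 - Complex.I • (z.2 : A) := fun z => by
    rw [hf, map_add, LinearMap.map_smulₛₗ, z.1.2.2, z.2.2.2, Complex.conj_I, neg_smul,
      sub_eq_add_neg]
  have hbij : Function.Bijective f := by
    constructor
    · refine (injective_iff_map_eq_zero f).2 fun z hz => ?_
      have h1 := hf z
      have h2 := htf z
      rw [hz] at h1 h2
      rw [ZeroMemClass.coe_zero] at h1 h2
      rw [map_zero] at h2
      have h3 : (z.1 : A) = 0 := by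
        have : (2 : ℂ) • (z.1 : A) = 0 := by
          have e : (2 : ℂ) • (z.1 : A) =
            (z.1 + Complex.I • (z.2 : A)) + (z.1 - Complex.I • (z.2 : A)) := by module
          rw [e, ← h1, ← h2, add_zero]
        simpa using this
      have h4 : (z.2 : A) = 0 := by
        rw [h3, zero_add] at h1
        simpa using h1.symm
      exact Prod.ext (Subtype.ext h3) (Subtype.ext h4)
    · intro w
      have ht := hW w w.2
      refine ⟨(⟨(1 / 2 : ℂ) • (w + τ w), W.smul_mem _ (W.add_mem w.2 ht), ?_⟩,
        ⟨(-Complex.I / 2 : ℂ) • (w - τ w), W.smul_mem _ (W.sub_mem w.2 ht), ?_⟩), ?_⟩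
      · rw [LinearMap.map_smulₛₗ, map_add, hτ, add_comm]
        congr 1
        simp [map_ofNat (starRingEnd ℂ) 2]
      · rw [LinearMap.map_smulₛₗ, map_sub, hτ, ← neg_sub, smul_neg, ← neg_smul]
        congr 1
        simp [map_ofNat (starRingEnd ℂ) 2]
        ring
      · ext1
        rw [hf]
        change (1 / 2 : ℂ) • (w + τ w) + Complex.I • (-Complex.I / 2 : ℂ) • (w - τ w) = (w : A)
        rw [smul_smul, mul_div_assoc', mul_neg, Complex.I_mul_I]
        module
  have h1 := (LinearEquiv.ofBijective f hbij).finrank_eq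
  have h2 := Module.finrank_mul_finrank ℝ ℂ W
  rw [Module.finrank_prod] at h1
  rw [Complex.finrank_real_complex] at h2
  omega

end FixedPoints

section Corners

variable {K V A ι : Type*} [Field K] [AddCommGroup V] [Module K V] [FiniteDimensional K V]
  [AddCommGroup A] [Module K A] [Fintype ι] [DecidableEq ι]

/-- The dimension of a sum of Peirce corners `∑ i, b i * End V * a i`. -/
theorem finrank_corners (e : A ≃ₗ[K] Module.End K V) {a b : ι → Module.End K V}
    (ha : ∀ i j, a i * a j = if i = j then a i else 0)
    (hb : ∀ i j, b i * b j = if i = j then b i else 0) {W : Submodule K A}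
    (hW : ∀ x, x ∈ W ↔ ∑ i, b i * e x * a i = e x) :
    Module.finrank K W =
      ∑ i, Module.finrank K (LinearMap.range (a i)) * Module.finrank K (LinearMap.range (b i)) := by
  have hfix : ∀ {c : ι → Module.End K V}, (∀ i j, c i * c j = if i = j then c i else 0) →
      ∀ i j (v : LinearMap.range (c j)), c i v = if i = j then (v : V) else 0 := by
    rintro c hc i j ⟨_, w, rfl⟩
    change (c i * c j) w = _
    rw [hc]
    split_ifs with h
    · rw [h]
    · rfl
  -- Orthogonality of the idempotents makes the blocks `range (a i) → range (b i)` independent, and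
  -- the defining equation of `W` says that they are all there is.
  let f : W →ₗ[K] ∀ i, LinearMap.range (a i) →ₗ[K] LinearMap.range (b i) :=
    { toFun := fun x i => (b i).rangeRestrict ∘ₗ e x ∘ₗ (LinearMap.range (a i)).subtype
      map_add' := fun x y => by ext; simp
      map_smul' := fun r x => by ext; simp }
  have hf : ∀ x i v, (f x i v : V) = b i (e x v) := fun x i v => rfl
  have hbij : Function.Bijective f := by
    constructor
    · refine (injective_iff_map_eq_zero f).2 fun x hx => ?_
      have h1 := (hW x).1 x.2
      have h2 : e x = 0 := by
        rw [← h1]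
        refine Finset.sum_eq_zero fun i _ => ?_
        ext1 v
        have := hf x i ⟨a i v, LinearMap.mem_range_self _ _⟩
        rw [hx] at this
        exact this.symm
      exact Subtype.ext (e.map_eq_zero_iff.1 h2)
    · intro g
      let y : Module.End K V :=
        ∑ i, (LinearMap.range (b i)).subtype ∘ₗ g i ∘ₗ (a i).rangeRestrict
      have hy : ∀ v, y v = ∑ i, (g i ⟨a i v, LinearMap.mem_range_self _ _⟩ : V) := fun v => by
        simp only [y, LinearMap.sum_apply]; rfl
      have hya : ∀ i (v : LinearMap.range (a i)), y v = g i v := by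
        intro i v
        rw [hy, Finset.sum_eq_single i]
        · congr 2
          exact Subtype.ext (by simp [hfix ha])
        · intro j _ hj
          have : (⟨a j v, LinearMap.mem_range_self _ _⟩ : LinearMap.range (a j)) = 0 :=
            Subtype.ext (by simp [hfix ha, hj])
          rw [this]; simp
        · simp
      have hyW : e.symm y ∈ W := by
        rw [hW, e.apply_symm_apply]
        ext1 v
        rw [hy, LinearMap.sum_apply]
        refine Finset.sum_congr rfl fun i _ => ?_
        change b i (y (a i v)) = _
        rw [hya i ⟨a i v, LinearMap.mem_range_self _ _⟩, hfix hb, if_pos rfl]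
      refine ⟨⟨_, hyW⟩, ?_⟩
      ext i v
      rw [hf]
      change b i (e (e.symm y) v) = _
      rw [e.apply_symm_apply, hya, hfix hb, if_pos rfl]
  rw [(LinearEquiv.ofBijective f hbij).finrank_eq, Module.finrank_pi_fintype]
  simp [Module.finrank_linearMap]

theorem finrank_range_of_idempotent [CharZero K] {a : Module.End K V} (ha : a * a = a) :
    (Module.finrank K (LinearMap.range a) : K) = LinearMap.trace K V a :=
  (LinearMap.IsIdempotentElem.isProj_range a ha).trace.symm

end Corners

variable {n : ℕ}

theorem trace_tensorOp (A B : Matrix (Fin n) (Fin n) ℂ) :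
    LinearMap.trace ℂ (Bip n) (tensorOp A B) = A.trace * B.trace := by
  rw [tensorOp, LinearMap.trace_eq_matrix_trace ℂ (EuclideanSpace.basisFun _ ℂ).toBasis,
    ← Matrix.trace_kronecker]
  congr 1
  ext p q
  simp [LinearMap.toMatrix_apply, Matrix.toLpLin_apply]

/-- A semilinear bijection over the automorphism of complex conjugation preserves rank. -/
theorem finrank_map_flip (S : Submodule ℂ (Bip n)) :
    Module.finrank ℂ (S.map (flip n)) = Module.finrank ℂ S := by
  symm
  let j : S → S.map (flip n) := fun v => ⟨flip n v, Submodule.mem_map_of_mem v.2⟩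
  have hj : Function.Bijective j := by
    constructor
    · intro v w h
      have : flip n v = flip n w := congrArg Subtype.val h
      exact Subtype.ext (by rw [← flip_flip (v : Bip n), this, flip_flip])
    · rintro ⟨_, v, hv, rfl⟩
      exact ⟨⟨v, hv⟩, rfl⟩
  let e : S ≃+ S.map (flip n) :=
    { Equiv.ofBijective j hj with map_add' := fun v w => Subtype.ext (map_add (flip n) _ _) }
  have := rank_eq_of_equiv_equiv (starRingEnd ℂ) e (starRingAut (R := ℂ)).bijective
    (fun r m => Subtype.ext ((flip n).map_smulₛₗ r (m : Bip n)))
  exact congrArg Cardinal.toNat this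

end FlipSubspace

/-! ### Sector decomposition and tangent spaces of the invariant subspaces. -/

namespace FlipSubspace

open scoped Kronecker ComplexOrder Matrix

variable {n : ℕ}

/-- The three sectors of `ℂⁿ ⊗ ℂⁿ`: the `+1` eigenspace of `X ⊗ X`, and the two parts
`ran (1 ± X) ⊗ ran (1 ∓ X)` of its `-1` eigenspace. -/
noncomputable def sectorProj (n : ℕ) : Fin 3 → Module.End ℂ (Bip n) :=
  ![1 - mixedProj n - mixedProj' n, mixedProj n, mixedProj' n]

theorem sectorProj_mul (i j : Fin 3) :
    sectorProj n i * sectorProj n j = if i = j then sectorProj n i else 0 := by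
  fin_cases i <;> fin_cases j <;>
    simp [sectorProj, mul_sub, sub_mul, mixedProj_mul_self, mixedProj'_mul_self,
      mixedProj_mul_mixedProj', mixedProj'_mul_mixedProj]

theorem sum_sectorProj : ∑ i, sectorProj n i = 1 := by
  simp only [Fin.sum_univ_three, sectorProj, Matrix.cons_val]
  abel

theorem IsInvariant.sectorProj_mem {S : Submodule ℂ (Bip n)} (hS : IsInvariant S) (i : Fin 3)
    {v : Bip n} (hv : v ∈ S) : sectorProj n i v ∈ S := by
  fin_cases i
  · exact S.sub_mem (S.sub_mem hv (hS.2 v hv)) (hS.mixedProj'_mem hv)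
  · exact hS.2 v hv
  · exact hS.mixedProj'_mem hv

/-- The range of `sectorProj`. -/
noncomputable def sector (n : ℕ) (i : Fin 3) : Submodule ℂ (Bip n) :=
  LinearMap.range (sectorProj n i)

theorem mem_sector {i : Fin 3} {v : Bip n} : v ∈ sector n i ↔ sectorProj n i v = v := by
  constructor
  · rintro ⟨w, rfl⟩
    rw [← Module.End.mul_apply, sectorProj_mul, if_pos rfl]
  · intro h
    exact ⟨v, h⟩

theorem sectorProj_apply_of_mem {i j : Fin 3} {v : Bip n} (hv : v ∈ sector n j) :
    sectorProj n i v = if i = j then v else 0 := by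
  rw [← mem_sector.1 hv, ← Module.End.mul_apply, sectorProj_mul]
  split_ifs with h
  · rw [h]
  · rfl

theorem map_flip_sector_one : (sector n 1).map (flip n) = sector n 2 := by
  ext v
  rw [mem_sector]
  constructor
  · rintro ⟨w, hw, rfl⟩
    rw [SetLike.mem_coe, mem_sector] at hw
    change mixedProj' n (flip n w) = _
    rw [← flip_mixedProj]
    exact congrArg _ hw
  · intro h
    refine ⟨flip n v, ?_, flip_flip v⟩
    rw [SetLike.mem_coe, mem_sector]
    change mixedProj n (flip n v) = _
    rw [← flip_mixedProj']
    exact congrArg _ h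

/-- The rank of a projection is its trace, and `tr X = 0` for even `n`, so `tr (1 ± X) = n`. -/
theorem four_mul_finrank_sector (hn : Even n) :
    4 * Module.finrank ℂ (sector n 1) = n ^ 2 := by
  have h := finrank_range_of_idempotent (mixedProj_mul_self (n := n))
  have h2 : LinearMap.trace ℂ (Bip n) (mixedProj n) = (1 / 4) * (n ^ 2 : ℂ) := by
    rw [mixedProj, map_smul, trace_tensorOp, Matrix.trace_add, Matrix.trace_sub,
      antiDiag_trace hn, Matrix.trace_one]
    simp [pow_two]
  rw [h2] at h
  have : ((4 * Module.finrank ℂ (sector n 1) : ℕ) : ℂ) = ((n ^ 2 : ℕ) : ℂ) := by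
    push_cast
    change 4 * (Module.finrank ℂ (LinearMap.range (mixedProj n)) : ℂ) = _
    rw [h]; ring
  exact_mod_cast this

theorem finrank_sector_two : Module.finrank ℂ (sector n 2) = Module.finrank ℂ (sector n 1) := by
  rw [← map_flip_sector_one, finrank_map_flip]

/-- The compression of the sector projections to an invariant subspace. -/
noncomputable def compress (S : Submodule ℂ (Bip n)) (i : Fin 3) : Module.End ℂ (Bip n) :=
  (S.starProjection : Bip n →ₗ[ℂ] Bip n) * sectorProj n i

section

variable {S : Submodule ℂ (Bip n)}

theorem IsInvariant.starProjection_sectorProj (hS : IsInvariant S) (i : Fin 3) (v : Bip n) :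
    S.starProjection (sectorProj n i v) = sectorProj n i (S.starProjection v) :=
  starProjection_comm_of_mapsTo (f := (sectorProj n i).toAddMonoidHom)
    (fun _ hv => hS.sectorProj_mem i hv) (fun _ hv => hS.orthogonal.sectorProj_mem i hv) v

theorem IsInvariant.starProjection_flip (hS : IsInvariant S) (v : Bip n) :
    S.starProjection (flip n v) = flip n (S.starProjection v) :=
  starProjection_comm_of_mapsTo (f := (flip n).toAddMonoidHom)
    (fun _ hv => hS.1 _ hv) (fun _ hv => hS.orthogonal.1 _ hv) v

theorem compress_apply (i : Fin 3) (v : Bip n) :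
    compress S i v = S.starProjection (sectorProj n i v) := rfl

theorem IsInvariant.compress_mul (hS : IsInvariant S) (i j : Fin 3) :
    compress S i * compress S j = if i = j then compress S i else 0 := by
  ext1 v
  rw [Module.End.mul_apply, compress_apply, compress_apply, ← hS.starProjection_sectorProj,
    ← Module.End.mul_apply (sectorProj n i), sectorProj_mul,
    Submodule.starProjection_eq_self_iff.2 (S.starProjection_apply_mem _)]
  split_ifs
  · rfl
  · simp

theorem IsInvariant.range_compress (hS : IsInvariant S) (i : Fin 3) :
    LinearMap.range (compress S i) = S ⊓ sector n i := by
  ext v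
  rw [Submodule.mem_inf, mem_sector]
  constructor
  · rintro ⟨w, rfl⟩
    refine ⟨S.starProjection_apply_mem _, ?_⟩
    rw [compress_apply, ← hS.starProjection_sectorProj, ← Module.End.mul_apply, sectorProj_mul,
      if_pos rfl]
  · rintro ⟨h1, h2⟩
    refine ⟨v, ?_⟩
    rw [compress_apply, h2, Submodule.starProjection_eq_self_iff.2 h1]

/-- The compressions to `S` and `Sᗮ` are idempotents with sum `sectorProj n i`; compare traces. -/
theorem IsInvariant.finrank_inf_sector_add (hS : IsInvariant S) (i : Fin 3) :
    Module.finrank ℂ ↥(S ⊓ sector n i) + Module.finrank ℂ ↥(Sᗮ ⊓ sector n i) =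
      Module.finrank ℂ (sector n i) := by
  have h1 := finrank_range_of_idempotent (by simpa using hS.compress_mul i i)
  have h2 := finrank_range_of_idempotent (by simpa using hS.orthogonal.compress_mul i i)
  have h3 := finrank_range_of_idempotent (by simpa using sectorProj_mul (n := n) i i)
  have h4 : compress S i + compress Sᗮ i = sectorProj n i := by
    ext1 v
    rw [LinearMap.add_apply, compress_apply, compress_apply,
      Submodule.starProjection_add_starProjection_orthogonal]
  rw [hS.range_compress] at h1
  rw [hS.orthogonal.range_compress] at h2
  have h5 : ((Module.finrank ℂ ↥(S ⊓ sector n i) + Module.finrank ℂ ↥(Sᗮ ⊓ sector n i) : ℕ) : ℂ) =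
      (Module.finrank ℂ (sector n i) : ℂ) := by
    rw [Nat.cast_add, h1, h2, ← map_add, h4, ← h3]; rfl
  exact_mod_cast h5

theorem IsInvariant.sum_finrank_inf_sector (hS : IsInvariant S) :
    ∑ i, Module.finrank ℂ ↥(S ⊓ sector n i) = Module.finrank ℂ S := by
  have h1 := fun i => finrank_range_of_idempotent (by simpa using hS.compress_mul i i)
  have hid : (S.starProjection : Bip n →ₗ[ℂ] Bip n) * (S.starProjection : Bip n →ₗ[ℂ] Bip n) =
      (S.starProjection : Bip n →ₗ[ℂ] Bip n) := by
    ext1 v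
    exact Submodule.starProjection_eq_self_iff.2 (S.starProjection_apply_mem v)
  have h2 := finrank_range_of_idempotent hid
  rw [show LinearMap.range (S.starProjection : Bip n →ₗ[ℂ] Bip n) = S from
    Submodule.range_starProjection S] at h2
  have h3 : ∑ i, compress S i = (S.starProjection : Bip n →ₗ[ℂ] Bip n) := by
    simp only [compress]
    rw [← Finset.mul_sum, sum_sectorProj, mul_one]
  have h4 : ((∑ i, Module.finrank ℂ ↥(S ⊓ sector n i) : ℕ) : ℂ) = Module.finrank ℂ S := by
    rw [h2, ← h3, map_sum, Nat.cast_sum]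
    refine Finset.sum_congr rfl fun i _ => ?_
    rw [← h1, hS.range_compress]
  exact_mod_cast h4

theorem IsInvariant.finrank_inf_sector_two (hS : IsInvariant S) :
    Module.finrank ℂ ↥(S ⊓ sector n 2) = Module.finrank ℂ ↥(S ⊓ sector n 1) := by
  have h : S ⊓ sector n 2 = (S ⊓ sector n 1).map (flip n) := by
    rw [← map_flip_sector_one]
    ext v
    constructor
    · rintro ⟨h1, w, hw, rfl⟩
      refine ⟨w, ⟨?_, hw⟩, rfl⟩
      have := hS.1 _ h1
      rwa [flip_flip] at this
    · rintro ⟨w, ⟨h1, h2⟩, rfl⟩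
      exact ⟨hS.1 _ h1, w, h2, rfl⟩
  rw [h, finrank_map_flip]

/-- The operators tangent to `S` that commute with all sector projections. -/
noncomputable def tangentComplex (S : Submodule ℂ (Bip n)) : Submodule ℂ (Bip n →L[ℂ] Bip n) where
  carrier := {x | IsTangent S x ∧ ∀ i v, x (sectorProj n i v) = sectorProj n i (x v)}
  add_mem' := by
    rintro x y ⟨⟨h1, h2⟩, h3⟩ ⟨⟨h1', h2'⟩, h3'⟩
    refine ⟨⟨fun v => ?_, fun v hv => ?_⟩, fun i v => ?_⟩
    · exact Sᗮ.add_mem (h1 v) (h1' v)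
    · simp [h2 v hv, h2' v hv]
    · simp [h3, h3']
  zero_mem' := by
    refine ⟨⟨fun v => ?_, fun v hv => ?_⟩, fun i v => ?_⟩ <;> simp
  smul_mem' := by
    rintro c x ⟨⟨h1, h2⟩, h3⟩
    refine ⟨⟨fun v => ?_, fun v hv => ?_⟩, fun i v => ?_⟩
    · exact Sᗮ.smul_mem c (h1 v)
    · simp [h2 v hv]
    · simp [h3]

theorem mem_tangentComplex {x : Bip n →L[ℂ] Bip n} : x ∈ tangentComplex S ↔
    IsTangent S x ∧ ∀ i v, x (sectorProj n i v) = sectorProj n i (x v) := Iff.rfl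

/-- Commuting with the sector projections means being block diagonal, with one free block from `S`
to `Sᗮ` in each sector. -/
theorem IsInvariant.finrank_tangentComplex (hS : IsInvariant S) :
    Module.finrank ℂ (tangentComplex S) =
      ∑ i, Module.finrank ℂ ↥(S ⊓ sector n i) * Module.finrank ℂ ↥(Sᗮ ⊓ sector n i) := by
  rw [finrank_corners (LinearMap.toContinuousLinearMap (𝕜 := ℂ) (E := Bip n) (F' := Bip n)).symm
    hS.compress_mul hS.orthogonal.compress_mul]
  · refine Finset.sum_congr rfl fun i _ => ?_
    rw [hS.range_compress, hS.orthogonal.range_compress]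
  · intro x
    have e : ((∑ i, compress Sᗮ i * (LinearMap.toContinuousLinearMap (𝕜 := ℂ) (E := Bip n)
        (F' := Bip n)).symm x * compress S i = LinearMap.toContinuousLinearMap.symm x) ↔
        ∀ v, ∑ i, compress Sᗮ i (x (compress S i v)) = x v) := by
      rw [LinearMap.ext_iff]
      refine forall_congr' fun v => ?_
      rw [LinearMap.sum_apply]
      rfl
    rw [e, mem_tangentComplex]
    constructor
    · rintro ⟨ht, hc⟩ v
      have h1 : ∀ i, compress Sᗮ i (x (compress S i v)) = sectorProj n i (x v) := fun i => by
        rw [compress_apply, compress_apply, ht.apply_starProjection, hc, ← Module.End.mul_apply,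
          sectorProj_mul, if_pos rfl]
        exact Submodule.starProjection_eq_self_iff.2 (hS.orthogonal.sectorProj_mem i (ht.1 v))
      simp only [h1]
      rw [← LinearMap.sum_apply, sum_sectorProj, Module.End.one_apply]
    · intro h
      refine ⟨⟨fun v => ?_, fun v hv => ?_⟩, fun i v => ?_⟩
      · rw [← h]
        exact Sᗮ.sum_mem fun i _ => Submodule.starProjection_apply_mem _ _
      · rw [← h]
        refine Finset.sum_eq_zero fun i _ => ?_
        rw [compress_apply (S := S), (Submodule.starProjection_apply_eq_zero_iff _).2
          (hS.orthogonal.sectorProj_mem i hv), map_zero, map_zero]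
      · rw [← h, ← h v, map_sum]
        refine Finset.sum_congr rfl fun j _ => ?_
        rw [compress_apply (S := S), compress_apply (S := S), compress_apply, compress_apply,
          ← hS.orthogonal.starProjection_sectorProj, ← Module.End.mul_apply,
          ← Module.End.mul_apply (sectorProj n i), sectorProj_mul, sectorProj_mul]
        by_cases hij : i = j
        · subst hij; simp
        · simp [hij, Ne.symm hij]

/-- Conjugation of operators by the flip. -/
noncomputable def conjFlip (n : ℕ) :
    (Bip n →L[ℂ] Bip n) →ₛₗ[starRingEnd ℂ] (Bip n →L[ℂ] Bip n) where
  toFun x := LinearMap.toContinuousLinearMap ((flip n).comp ((x : Bip n →ₗ[ℂ] Bip n).comp (flip n)))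
  map_add' x y := by ext1 v; simp
  map_smul' c x := by ext1 v; simp

theorem conjFlip_apply (x : Bip n →L[ℂ] Bip n) (v : Bip n) :
    conjFlip n x v = flip n (x (flip n v)) := rfl

theorem flip_sectorProj_zero (v : Bip n) :
    flip n (sectorProj n 0 v) = sectorProj n 0 (flip n v) := by
  change flip n (v - mixedProj n v - mixedProj' n v) =
    flip n v - mixedProj n (flip n v) - mixedProj' n (flip n v)
  rw [map_sub, map_sub, flip_mixedProj, flip_mixedProj']
  abel

/-- The real tangent space at `S` of the set of invariant subspaces. -/
noncomputable def tangentReal (S : Submodule ℂ (Bip n)) : Submodule ℝ (Bip n →L[ℂ] Bip n) :=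
  fixedIn (conjFlip n) (tangentComplex S)

theorem mem_tangentReal {x : Bip n →L[ℂ] Bip n} : x ∈ tangentReal S ↔
    IsTangent S x ∧ (∀ v, x (mixedProj n v) = mixedProj n (x v)) ∧
      ∀ v, x (flip n v) = flip n (x v) := by
  rw [tangentReal, mem_fixedIn, mem_tangentComplex, and_assoc]
  refine and_congr_right fun ht => ?_
  have hfix : conjFlip n x = x ↔ ∀ v, x (flip n v) = flip n (x v) := by
    rw [ContinuousLinearMap.ext_iff]
    refine forall_congr' fun v => ?_
    rw [conjFlip_apply]
    constructor
    · intro h; rw [← h, flip_flip]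
    · intro h; rw [h, flip_flip]
  rw [hfix]
  constructor
  · rintro ⟨h1, h2⟩
    exact ⟨h1 1, h2⟩
  · rintro ⟨h1, h2⟩
    -- `mixedProj'` is the flip conjugate of `mixedProj`.
    have h3 : ∀ v, x (mixedProj' n v) = mixedProj' n (x v) := fun v => by
      rw [← flip_flip (mixedProj' n v), flip_mixedProj', h2, h1, flip_mixedProj, h2, flip_flip]
    refine ⟨fun i v => ?_, h2⟩
    fin_cases i
    · change x (v - mixedProj n v - mixedProj' n v) = x v - mixedProj n (x v) - mixedProj' n (x v)
      rw [map_sub, map_sub, h1, h3]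
    · exact h1 v
    · exact h3 v

/-- The flip-commuting operators are a real form of `tangentComplex S`, so the complex count becomes
a real one. The two exchanged sectors contribute equally, whence the factor `2`. -/
theorem IsInvariant.finrank_tangentReal (hS : IsInvariant S) :
    Module.finrank ℝ (tangentReal S) =
      Module.finrank ℂ ↥(S ⊓ sector n 0) * Module.finrank ℂ ↥(Sᗮ ⊓ sector n 0) +
      2 * (Module.finrank ℂ ↥(S ⊓ sector n 1) * Module.finrank ℂ ↥(Sᗮ ⊓ sector n 1)) := by
  rw [tangentReal, finrank_fixedIn, hS.finrank_tangentComplex, Fin.sum_univ_three,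
    hS.finrank_inf_sector_two, hS.orthogonal.finrank_inf_sector_two]
  · ring
  · intro x
    ext1 v
    simp [conjFlip_apply]
  · intro x hx
    rw [mem_tangentComplex] at hx ⊢
    obtain ⟨ht, hc⟩ := hx
    refine ⟨⟨fun v => hS.orthogonal.1 _ (ht.1 _), fun v hv => ?_⟩, fun i v => ?_⟩
    · rw [conjFlip_apply, ht.2 _ (hS.orthogonal.1 v hv), map_zero]
    · rw [conjFlip_apply, conjFlip_apply]
      fin_cases i
      · change flip n (x (flip n (sectorProj n 0 v))) = sectorProj n 0 (flip n (x (flip n v)))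
        rw [flip_sectorProj_zero, hc, flip_sectorProj_zero]
      · change flip n (x (flip n (mixedProj n v))) = mixedProj n (flip n (x (flip n v)))
        rw [flip_mixedProj, ← flip_mixedProj']
        exact congrArg _ (hc 2 _)
      · change flip n (x (flip n (mixedProj' n v))) = mixedProj' n (flip n (x (flip n v)))
        rw [flip_mixedProj', ← flip_mixedProj]
        exact congrArg _ (hc 1 _)

end

end FlipSubspace

/-! ### The piece of largest dimension and a base point on it. -/

namespace FlipSubspace

open scoped Kronecker ComplexOrder Matrix

/-- A maximiser cannot have `k = 0` or `k = 2e`, since moving two dimensions between the first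
sector and the exchanged pair would increase the dimension of the piece. -/
theorem exists_optimal_dimensions {e d : ℕ} (hd : 1 ≤ d) (h : d / 2 + 2 ≤ 2 * e) :
    ∃ k m : ℕ, k + 2 * m = d ∧ 1 ≤ k ∧ k + 1 ≤ 2 * e ∧ m ≤ e ∧
      ∀ k' m' : ℕ, k' + 2 * m' = d → k' ≤ 2 * e → m' ≤ e →
        k' * (2 * e - k') + 2 * (m' * (e - m')) ≤ k * (2 * e - k) + 2 * (m * (e - m)) := by
  -- Integer values avoid truncated subtraction; `hf` matches the two forms in the admissible range.
  let f : ℕ × ℕ → ℤ := fun z => z.1 * (2 * e - z.1) + 2 * (z.2 * (e - z.2))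
  have hf : ∀ k m : ℕ, k ≤ 2 * e → m ≤ e →
      ((k * (2 * e - k) + 2 * (m * (e - m)) : ℕ) : ℤ) = f (k, m) := by
    intro k m hk hm
    simp only [f]
    push_cast [Nat.cast_sub hk, Nat.cast_sub hm]
    ring
  let s : Finset (ℕ × ℕ) := (Finset.range (2 * e + 1) ×ˢ Finset.range (e + 1)).filter
    fun z => z.1 + 2 * z.2 = d
  have hs : ∀ k m, (k, m) ∈ s ↔ k ≤ 2 * e ∧ m ≤ e ∧ k + 2 * m = d := by
    intro k m
    simp only [s, Finset.mem_filter, Finset.mem_product, Finset.mem_range]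
    omega
  have hne : s.Nonempty := by
    rcases le_total (d / 2) e with h1 | h1
    · exact ⟨(d % 2, d / 2), (hs _ _).2 (by omega)⟩
    · exact ⟨(d - 2 * e, e), (hs _ _).2 (by omega)⟩
  obtain ⟨⟨k, m⟩, hmem, hmax⟩ := Finset.exists_max_image s f hne
  obtain ⟨hk, hm, hkm⟩ := (hs k m).1 hmem
  refine ⟨k, m, hkm, ?_, ?_, hm, fun k' m' h1 h2 h3 => ?_⟩
  · by_contra hk0
    obtain rfl : k = 0 := by omega
    -- The gain is `2e + 4m - 6`, positive because `m ≥ 1` and `m + 2 ≤ 2e`.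
    have := hmax (2, m - 1) ((hs _ _).2 (by omega))
    simp only [f] at this
    have hm1 : 1 ≤ m := by omega
    push_cast [Nat.cast_sub hm1] at this
    have h5 : (m : ℤ) + 2 ≤ 2 * e := by omega
    have h6 : (1 : ℤ) ≤ m := by omega
    nlinarith
  · by_contra hk0
    obtain rfl : k = 2 * e := by omega
    -- Here `d / 2 = e + m`, so `m + 2 ≤ e`, and the gain `6e - 4m - 6` is positive.
    have := hmax (2 * e - 2, m + 1) ((hs _ _).2 (by omega))
    simp only [f] at this
    have he : 2 ≤ 2 * e := by omega
    push_cast [Nat.cast_sub he] at this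
    have h5 : (m : ℤ) + 2 ≤ e := by omega
    nlinarith
  · have := hmax (k', m') ((hs _ _).2 ⟨h2, h3, h1⟩)
    rw [← hf _ _ h2 h3, ← hf _ _ hk hm] at this
    exact_mod_cast this

variable {n : ℕ}

/-- Add one dimension at a time: as long as `T ≠ W`, the real form of `Tᗮ ⊓ W` contains a nonzero
flip-fixed vector, whose complex line can be adjoined. -/
theorem exists_flip_invariant {U W : Submodule ℂ (Bip n)} (hUW : U ≤ W)
    (hU : ∀ v ∈ U, flip n v ∈ U) (hW : ∀ v ∈ W, flip n v ∈ W) {j : ℕ}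
    (hj : Module.finrank ℂ U ≤ j) (hjW : j ≤ Module.finrank ℂ W) :
    ∃ T : Submodule ℂ (Bip n), U ≤ T ∧ T ≤ W ∧ (∀ v ∈ T, flip n v ∈ T) ∧
      Module.finrank ℂ T = j := by
  induction j, hj using Nat.le_induction with
  | base => exact ⟨U, le_rfl, hUW, hU, rfl⟩
  | succ j hj ih =>
    obtain ⟨T, hUT, hTW, hT, hTj⟩ := ih (by omega)
    have hd := Submodule.finrank_add_inf_finrank_orthogonal hTW
    have hinv : ∀ v ∈ Tᗮ ⊓ W, flip n v ∈ Tᗮ ⊓ W := by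
      rintro v ⟨h1, h2⟩
      refine ⟨?_, hW v h2⟩
      rw [SetLike.mem_coe, Submodule.mem_orthogonal'] at h1 ⊢
      intro u hu
      rw [inner_flip, ← inner_conj_symm, h1 _ (hT u hu), map_zero]
    have hfix := finrank_fixedIn (flip_flip (n := n)) hinv
    have hpos : 0 < Module.finrank ℝ (fixedIn (flip n) (Tᗮ ⊓ W)) := by omega
    have := Module.nontrivial_of_finrank_pos hpos
    obtain ⟨⟨v, ⟨hvT, hvW⟩, hv⟩, hv0⟩ :=
      exists_ne (0 : fixedIn (flip n) (Tᗮ ⊓ W))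
    have hv0 : v ≠ 0 := fun h => hv0 (Subtype.ext h)
    refine ⟨T ⊔ ℂ ∙ v, hUT.trans le_sup_left,
      sup_le hTW ((Submodule.span_singleton_le_iff_mem _ _).2 hvW), ?_, ?_⟩
    · intro w hw
      obtain ⟨t, ht, s, hs, rfl⟩ := Submodule.mem_sup.1 hw
      obtain ⟨c, rfl⟩ := Submodule.mem_span_singleton.1 hs
      rw [map_add, LinearMap.map_smulₛₗ, hv]
      exact Submodule.add_mem_sup (hT t ht)
        (Submodule.smul_mem _ _ (Submodule.mem_span_singleton_self v))
    · have hdis : T ⊓ ℂ ∙ v = ⊥ := by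
        refine (T.isOrtho_iff_le.2 ?_ : T ⟂ ℂ ∙ v).disjoint.eq_bot
        rw [← Submodule.isOrtho_iff_le]
        refine Submodule.IsOrtho.symm (Submodule.isOrtho_iff_le.2 ?_)
        exact (Submodule.span_singleton_le_iff_mem _ _).2 hvT
      have := Submodule.finrank_sup_add_finrank_inf_eq T (ℂ ∙ v)
      rw [hdis, finrank_bot, finrank_span_singleton hv0] at this
      omega

theorem exists_le_finrank_eq {W : Submodule ℂ (Bip n)} {j : ℕ} (hj : j ≤ Module.finrank ℂ W) :
    ∃ T ≤ W, Module.finrank ℂ T = j := by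
  obtain ⟨f, hf⟩ := exists_linearIndependent_of_le_finrank hj
  have hf' : LinearIndependent ℂ fun i => (f i : Bip n) := hf.map' W.subtype W.ker_subtype
  refine ⟨Submodule.span ℂ (Set.range fun i => (f i : Bip n)), ?_, ?_⟩
  · rw [Submodule.span_le]
    rintro _ ⟨i, rfl⟩
    exact (f i).2
  · rw [finrank_span_eq_card hf', Fintype.card_fin]

theorem mem_sector_zero {v : Bip n} (h1 : mixedProj n v = 0) (h2 : mixedProj' n v = 0) :
    v ∈ sector n 0 := by
  rw [mem_sector]
  change v - mixedProj n v - mixedProj' n v = v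
  rw [h1, h2, sub_zero, sub_zero]

theorem ofMat_one_mem_sector : ofMat 1 ∈ sector n 0 := by
  refine mem_sector_zero (matForm_injective ?_) (matForm_injective ?_)
  · rw [matForm_mixedProj, matForm_ofMat, mul_one, one_add_mul_one_sub_antiDiag, smul_zero, map_zero]
  · rw [matForm_mixedProj', matForm_ofMat, mul_one, one_sub_mul_one_add_antiDiag, smul_zero,
      map_zero]

theorem ofMat_antiDiag_mem_sector : ofMat (antiDiag n) ∈ sector n 0 := by
  refine mem_sector_zero (matForm_injective ?_) (matForm_injective ?_)
  · rw [matForm_mixedProj, matForm_ofMat, map_zero, add_mul, one_mul, antiDiag_mul_self, add_comm,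
      one_add_mul_one_sub_antiDiag, smul_zero]
  · rw [matForm_mixedProj', matForm_ofMat, map_zero, sub_mul, one_mul, antiDiag_mul_self, ← neg_sub,
      neg_mul, one_sub_mul_one_add_antiDiag, neg_zero, smul_zero]

theorem inner_sectorProj (i : Fin 3) (v w : Bip n) :
    inner ℂ (sectorProj n i v) w = inner ℂ v (sectorProj n i w) := by
  fin_cases i
  · change inner ℂ (v - mixedProj n v - mixedProj' n v) w =
      inner ℂ v (w - mixedProj n w - mixedProj' n w)
    simp only [inner_sub_left, inner_sub_right, inner_mixedProj, inner_mixedProj']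
  · exact inner_mixedProj v w
  · exact inner_mixedProj' v w

theorem inner_eq_zero_of_sector {i j : Fin 3} (hij : i ≠ j) {v w : Bip n} (hv : v ∈ sector n i)
    (hw : w ∈ sector n j) : inner ℂ v w = 0 := by
  rw [← mem_sector.1 hv, inner_sectorProj, sectorProj_apply_of_mem hw, if_neg hij, inner_zero_right]

theorem finrank_sector_zero :
    Module.finrank ℂ (sector n 0) + 2 * Module.finrank ℂ (sector n 1) = n ^ 2 := by
  have hinv : IsInvariant (⊤ : Submodule ℂ (Bip n)) :=
    ⟨fun _ _ => Submodule.mem_top, fun _ _ => Submodule.mem_top⟩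
  have h := hinv.sum_finrank_inf_sector
  have e : ∀ i, Module.finrank ℂ ↥(⊤ ⊓ sector n i) = Module.finrank ℂ (sector n i) :=
    fun i => by rw [top_inf_eq]
  rw [Fin.sum_univ_three, e, e, e, finrank_sector_two, finrank_top,
    finrank_euclideanSpace, Fintype.card_prod, Fintype.card_fin] at h
  rw [pow_two, ← h]
  ring

/-- Invariant subspaces of all admissible sector dimensions, positioned so that they contain the
identity and are orthogonal to `X`. -/
theorem exists_invariant (hn : Even n) (hn0 : n ≠ 0) {k m : ℕ} (hk : 1 ≤ k)
    (hk' : k + 1 ≤ Module.finrank ℂ (sector n 0)) (hm : m ≤ Module.finrank ℂ (sector n 1)) :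
    ∃ S : Submodule ℂ (Bip n), IsInvariant S ∧ Module.finrank ℂ ↥(S ⊓ sector n 0) = k ∧
      Module.finrank ℂ ↥(S ⊓ sector n 1) = m ∧ ofMat 1 ∈ S ∧ ofMat (antiDiag n) ∈ Sᗮ := by
  have : NeZero n := ⟨hn0⟩
  have hI : (ofMat 1 : Bip n) ≠ 0 := fun h => by
    have := congrArg (matForm n) h
    rw [matForm_ofMat, map_zero] at this
    exact one_ne_zero this
  have hX : (ofMat (antiDiag n) : Bip n) ≠ 0 := fun h => by
    have h1 := congrArg (matForm n) h
    rw [matForm_ofMat, map_zero] at h1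
    have h2 := antiDiag_mul_self (n := n)
    rw [h1, zero_mul] at h2
    exact zero_ne_one h2
  have hIX : inner ℂ (ofMat (antiDiag n)) (ofMat 1 : Bip n) = 0 := by
    rw [inner_eq_trace, matForm_ofMat, matForm_ofMat, mul_one, antiDiag_conjTranspose,
      antiDiag_trace hn]
  have hfI : flip n (ofMat 1) = ofMat 1 := matForm_injective (by simp)
  have hfX : flip n (ofMat (antiDiag n)) = ofMat (antiDiag n) :=
    matForm_injective (by simp [antiDiag_conjTranspose])
  -- The first part is chosen between the line of the identity and the complement `W` of `X`, which
  -- is why `k` must stay one below the sector dimension. The identity lies in `W` because `tr X =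
  -- 0`.
  set W := (ℂ ∙ (ofMat (antiDiag n) : Bip n))ᗮ ⊓ sector n 0 with hWdef
  have hWr : Module.finrank ℂ W + 1 = Module.finrank ℂ (sector n 0) := by
    have := Submodule.finrank_add_inf_finrank_orthogonal
      ((Submodule.span_singleton_le_iff_mem _ _).2 (ofMat_antiDiag_mem_sector (n := n)))
    rw [finrank_span_singleton hX, ← hWdef] at this
    omega
  obtain ⟨S0, hIS0, hS0W, hS0f, hS0k⟩ := exists_flip_invariant
    (U := ℂ ∙ (ofMat 1 : Bip n)) (W := W) (j := k)
    ((Submodule.span_singleton_le_iff_mem _ _).2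
      ⟨Submodule.mem_orthogonal_singleton_iff_inner_right.2 hIX, ofMat_one_mem_sector⟩)
    (by
      intro v hv
      obtain ⟨c, rfl⟩ := Submodule.mem_span_singleton.1 hv
      rw [LinearMap.map_smulₛₗ, hfI]
      exact Submodule.smul_mem _ _ (Submodule.mem_span_singleton_self _))
    (by
      rintro v ⟨h1, h2⟩
      rw [SetLike.mem_coe, Submodule.mem_orthogonal_singleton_iff_inner_right] at h1
      refine ⟨Submodule.mem_orthogonal_singleton_iff_inner_right.2 ?_, ?_⟩
      · rw [← hfX, inner_flip_flip, ← inner_conj_symm, h1, map_zero]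
      · rw [SetLike.mem_coe, mem_sector, ← flip_sectorProj_zero, mem_sector.1 h2])
    (by rw [finrank_span_singleton hI]; exact hk) (by omega)
  -- Any `m`-plane in sector 1 will do: its flip lies in sector 2, and adjoining it restores flip
  -- invariance.
  obtain ⟨T, hT, hTm⟩ := exists_le_finrank_eq hm
  have hS0s : ∀ v ∈ S0, v ∈ sector n 0 := fun v hv => (hS0W hv).2
  have hT2 : ∀ v ∈ T.map (flip n), v ∈ sector n 2 := by
    rintro _ ⟨v, hv, rfl⟩
    rw [← map_flip_sector_one]
    exact Submodule.mem_map_of_mem (hT hv)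
  have hdec : ∀ v ∈ S0 ⊔ T ⊔ T.map (flip n), ∃ a ∈ S0, ∃ b ∈ T, ∃ c ∈ T.map (flip n),
      v = a + b + c := by
    intro v hv
    obtain ⟨u, hu, c, hc, rfl⟩ := Submodule.mem_sup.1 hv
    obtain ⟨a, ha, b, hb, rfl⟩ := Submodule.mem_sup.1 hu
    exact ⟨a, ha, b, hb, c, hc, rfl⟩
  have hmk : ∀ {a b c}, a ∈ S0 → b ∈ T → c ∈ T.map (flip n) →
      a + b + c ∈ S0 ⊔ T ⊔ T.map (flip n) := fun ha hb hc =>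
    Submodule.add_mem_sup (Submodule.add_mem_sup ha hb) hc
  have hp : ∀ {a b c}, a ∈ S0 → b ∈ T → c ∈ T.map (flip n) → ∀ i,
      sectorProj n i (a + b + c) = (if i = 0 then a else 0) + (if i = 1 then b else 0) +
        (if i = 2 then c else 0) := fun ha hb hc i => by
    rw [map_add, map_add, sectorProj_apply_of_mem (hS0s _ ha), sectorProj_apply_of_mem (hT hb),
      sectorProj_apply_of_mem (hT2 _ hc)]
  refine ⟨S0 ⊔ T ⊔ T.map (flip n), ⟨?_, ?_⟩, ?_, ?_, ?_, ?_⟩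
  · intro v hv
    obtain ⟨a, ha, b, hb, c, ⟨c', hc, rfl⟩, rfl⟩ := hdec v hv
    rw [map_add, map_add, flip_flip, add_right_comm]
    exact hmk (hS0f a ha) hc (Submodule.mem_map_of_mem hb)
  · intro v hv
    obtain ⟨a, ha, b, hb, c, hc, rfl⟩ := hdec v hv
    have := hp ha hb hc 1
    change sectorProj n 1 _ ∈ _
    rw [this]
    simpa using hmk S0.zero_mem hb (Submodule.zero_mem _)
  · suffices h : (S0 ⊔ T ⊔ T.map (flip n)) ⊓ sector n 0 = S0 by rw [h, hS0k]
    refine le_antisymm ?_ (le_inf (le_sup_left.trans le_sup_left) fun v hv => hS0s v hv)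
    rintro v ⟨hv, hv0⟩
    obtain ⟨a, ha, b, hb, c, hc, rfl⟩ := hdec v hv
    have h := hp ha hb hc 0
    rw [mem_sector.1 hv0] at h
    rw [h]
    simpa using ha
  · suffices h : (S0 ⊔ T ⊔ T.map (flip n)) ⊓ sector n 1 = T by rw [h, hTm]
    refine le_antisymm ?_ (le_inf (le_sup_right.trans le_sup_left) hT)
    rintro v ⟨hv, hv0⟩
    obtain ⟨a, ha, b, hb, c, hc, rfl⟩ := hdec v hv
    have h := hp ha hb hc 1
    rw [mem_sector.1 hv0] at h
    rw [h]
    simpa using hb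
  · exact Submodule.mem_sup_left (Submodule.mem_sup_left
      (hIS0 (Submodule.mem_span_singleton_self _)))
  · rw [Submodule.mem_orthogonal']
    intro v hv
    obtain ⟨a, ha, b, hb, c, hc, rfl⟩ := hdec v hv
    rw [inner_add_right, inner_add_right,
      Submodule.mem_orthogonal_singleton_iff_inner_right.1 (hS0W ha).1,
      inner_eq_zero_of_sector (by decide) ofMat_antiDiag_mem_sector (hT hb),
      inner_eq_zero_of_sector (by decide) ofMat_antiDiag_mem_sector (hT2 c hc), add_zero, add_zero]

end FlipSubspace

/-! ### Hausdorff measure of the set of invariant subspaces. -/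

namespace FlipSubspace

open scoped Kronecker ComplexOrder Matrix NNReal ENNReal
open MeasureTheory

section Hausdorff

variable {E Y : Type*} [NormedAddCommGroup E] [NormedSpace ℝ E] [FiniteDimensional ℝ E]
  [MetricSpace Y] [MeasurableSpace Y] [BorelSpace Y] {W : Submodule ℝ E} {c : W → Y} {K : ℝ≥0}

/-- Lipschitz maps do not create infinite measure. A dimension `s` above that of `W` is allowed
because smaller pieces must be measured in the top dimension. -/
theorem hausdorffMeasure_image_lt_top (hc : ∀ x y : W, dist (c x) (c y) ≤ K * ‖(x : E) - y‖)
    {s : ℕ} (hs : Module.finrank ℝ W ≤ s) (r : ℝ) :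
    μH[s] (c '' {x : W | ‖(x : E)‖ ≤ r}) < ∞ := by
  borelize ↥W
  have hK : LipschitzWith K c := LipschitzWith.of_dist_le_mul fun x y => by
    rw [Subtype.dist_eq, dist_eq_norm]; exact hc x y
  have hset : {x : W | ‖(x : E)‖ ≤ r} = Metric.closedBall 0 r := by
    ext x
    simp
  have hfin : μH[s] (Metric.closedBall (0 : W) r) < ∞ :=
    (Measure.hausdorffMeasure_mono (Nat.cast_le.2 hs) _).trans_lt measure_closedBall_lt_top
  rw [hset]
  exact (hK.hausdorffMeasure_image_le s.cast_nonneg _).trans_lt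
    (ENNReal.mul_lt_top (by simp) hfin)

theorem hausdorffMeasure_image_ne_zero {r : ℝ} (hr : 0 < r)
    (hc : ∀ x y : W, ‖(x : E)‖ < r → ‖(y : E)‖ < r →
      ‖(x : E) - y‖ ≤ K * dist (c x) (c y)) :
    μH[Module.finrank ℝ W] (c '' {x : W | ‖(x : E)‖ < r}) ≠ 0 := by
  borelize ↥W
  have hset : {x : W | ‖(x : E)‖ < r} = Metric.ball 0 r := by
    ext x
    simp
  rw [hset]
  have hK : AntilipschitzWith K fun x : Metric.ball (0 : W) r => c x :=
    AntilipschitzWith.of_le_mul_dist fun x y => by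
      rw [Subtype.dist_eq, Subtype.dist_eq, dist_eq_norm]
      exact hc x y (mem_ball_zero_iff.1 x.2) (mem_ball_zero_iff.1 y.2)
  have h := hK.le_hausdorffMeasure_image (Nat.cast_nonneg (Module.finrank ℝ W)) Set.univ
  rw [← isometry_subtype_coe.hausdorffMeasure_image (Or.inl (Nat.cast_nonneg _)),
    Set.image_univ, Set.image_univ, Subtype.range_coe] at h
  rw [Set.image_eq_range]
  intro h0
  rw [h0, mul_zero] at h
  exact (Metric.measure_ball_pos μH[Module.finrank ℝ W] (0 : W) hr).not_ge h

end Hausdorff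

variable {d n : ℕ}

/-- The linear map listing the matrix entries of an operator. -/
noncomputable def opEntries (n : ℕ) : (Bip n →L[ℂ] Bip n) →ₗ[ℂ]
    EuclideanSpace ℂ ((Fin n × Fin n) × (Fin n × Fin n)) where
  toFun x := WithLp.toLp 2 fun p => x (EuclideanSpace.single p.2 1) p.1
  map_add' _ _ := rfl
  map_smul' _ _ := rfl

theorem opEntries_injective : Function.Injective (opEntries n) := by
  intro x y h
  have h1 : (x : Bip n →ₗ[ℂ] Bip n) = y := by
    refine (EuclideanSpace.basisFun (Fin n × Fin n) ℂ).toBasis.ext fun q => ?_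
    ext p
    have h2 : x (EuclideanSpace.single q 1) p = y (EuclideanSpace.single q 1) p :=
      congrArg (fun v => v (p, q)) h
    simpa using h2
  exact ContinuousLinearMap.coe_injective h1

theorem dist_eq_norm_opEntries (S T : Gr d n) :
    dist S T = ‖opEntries n (S.1.starProjection - T.1.starProjection)‖ := by
  rw [map_sub, ← dist_eq_norm]
  rfl

theorem exists_dist_le (d n : ℕ) : ∃ K : ℝ≥0, ∀ S T : Gr d n,
    dist S T ≤ K * ‖S.1.starProjection - T.1.starProjection‖ := by
  refine ⟨‖LinearMap.toContinuousLinearMap (opEntries n)‖₊, fun S T => ?_⟩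
  rw [dist_eq_norm_opEntries]
  exact (LinearMap.toContinuousLinearMap (opEntries n)).le_opNorm _

theorem exists_norm_le_dist (d n : ℕ) : ∃ K : ℝ≥0, ∀ S T : Gr d n,
    ‖S.1.starProjection - T.1.starProjection‖ ≤ K * dist S T := by
  obtain ⟨K, -, hK⟩ := (opEntries n).exists_antilipschitzWith
    (LinearMap.ker_eq_bot.2 opEntries_injective)
  refine ⟨K, fun S T => ?_⟩
  rw [dist_eq_norm_opEntries]
  simpa using hK.le_mul_dist (S.1.starProjection - T.1.starProjection) 0

/-- Orthogonal projectors have operator norm at most one, so the Grassmannian embeds in a bounded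
set of a finite-dimensional space. -/
theorem totallyBounded_gr (A : Set (Gr d n)) : TotallyBounded A := by
  have hind : IsUniformInducing (projEntries : Gr d n → _) := ⟨rfl⟩
  have hb : Bornology.IsBounded (Set.range (projEntries : Gr d n → _)) := by
    refine (isBounded_iff_forall_norm_le).2
      ⟨‖LinearMap.toContinuousLinearMap (opEntries n)‖ * 1, ?_⟩
    rintro _ ⟨S, rfl⟩
    refine ((LinearMap.toContinuousLinearMap (opEntries n)).le_opNorm S.1.starProjection).trans ?_
    gcongr
    exact S.1.starProjection_norm_le
  refine (totallyBounded_image_iff hind).1 ?_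
  exact hb.isCompact_closure.totallyBounded.subset
    ((Set.image_subset_range _ _).trans subset_closure)

theorem tangentReal_isTangent {S : Submodule ℂ (Bip n)} (x : tangentReal S) :
    IsTangent S (x : Bip n →L[ℂ] Bip n) := (mem_tangentReal.1 x.2).1

section Chart

variable {S : Submodule ℂ (Bip n)} (h : Module.finrank ℂ S = d)

/-- The chart of the set of invariant subspaces at `S`, by graphs of tangent operators. -/
noncomputable def chart (x : tangentReal S) : Gr d n :=
  ⟨shear S x, (tangentReal_isTangent x).finrank_shear.trans h⟩

theorem chart_isInvariant (hS : IsInvariant S) (x : tangentReal S) :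
    IsInvariant (chart h x).1 := by
  obtain ⟨-, h1, h2⟩ := mem_tangentReal.1 x.2
  constructor
  · intro v hv
    obtain ⟨s, hs, rfl⟩ := mem_shear.1 hv
    exact mem_shear.2 ⟨flip n s, hS.1 s hs, by rw [h2, map_add]⟩
  · intro v hv
    obtain ⟨s, hs, rfl⟩ := mem_shear.1 hv
    exact mem_shear.2 ⟨mixedProj n s, hS.2 s hs, by rw [h1, map_add]⟩

/-- The operator whose graph is `T` inherits the symmetries common to `S`, `Sᗮ` and `T`, so it lies
in the real tangent space. -/
theorem exists_chart_eq (hS : IsInvariant S) {T : Gr d n} (hT : IsInvariant T.1)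
    (hST : ‖T.1.starProjection - S.starProjection‖ ≤ 1 / 2) :
    ∃ x : tangentReal S, ‖(x : Bip n →L[ℂ] Bip n)‖ ≤ 2 ∧ chart h x = T := by
  obtain ⟨x, hx, hx2, hTx⟩ := exists_shear_eq (T.2.trans h.symm) hST
  refine ⟨⟨x, mem_tangentReal.2 ⟨hx, fun v => ?_, fun v => ?_⟩⟩, hx2, Subtype.ext hTx.symm⟩
  · exact hx.comm_of_mapsTo (f := (mixedProj n).toAddMonoidHom) (fun v hv => hS.2 v hv)
      (fun v hv => hS.orthogonal.2 v hv) (hTx ▸ fun v hv => hT.2 v hv) v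
  · exact hx.comm_of_mapsTo (f := (flip n).toAddMonoidHom) (fun v hv => hS.1 v hv)
      (fun v hv => hS.orthogonal.1 v hv) (hTx ▸ fun v hv => hT.1 v hv) v

theorem exists_dist_chart_le : ∃ K : ℝ≥0, ∀ x y : tangentReal S,
    dist (chart h x) (chart h y) ≤ K * ‖(x : Bip n →L[ℂ] Bip n) - y‖ := by
  obtain ⟨K, hK⟩ := exists_dist_le d n
  refine ⟨K * 2, fun x y => (hK _ _).trans ?_⟩
  have := (tangentReal_isTangent x).norm_starProjection_shear_sub_le (tangentReal_isTangent y)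
  rw [NNReal.coe_mul, mul_assoc]
  gcongr
  exact this

theorem exists_norm_le_dist_chart : ∃ K : ℝ≥0, ∀ x y : tangentReal S,
    ‖(x : Bip n →L[ℂ] Bip n)‖ ≤ 1 → ‖(y : Bip n →L[ℂ] Bip n)‖ ≤ 1 →
    ‖(x : Bip n →L[ℂ] Bip n) - y‖ ≤ K * dist (chart h x) (chart h y) := by
  obtain ⟨K, hK⟩ := exists_norm_le_dist d n
  -- On the unit ball the factor `(2 + ‖y‖)(1 + ‖x‖)` is at most `6`.
  refine ⟨6 * K, fun x y hx hy => ?_⟩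
  have h1 := (tangentReal_isTangent x).norm_sub_le (tangentReal_isTangent y)
  have h2 := hK (chart h x) (chart h y)
  calc ‖(x : Bip n →L[ℂ] Bip n) - y‖
      ≤ (2 + 1) * (1 + 1) * (K * dist (chart h x) (chart h y)) :=
        h1.trans (by gcongr; exact h2)
    _ = ((6 * K : ℝ≥0) : ℝ) * dist (chart h x) (chart h y) := by push_cast; ring

theorem hausdorffMeasure_near_lt_top (h : Module.finrank ℂ S = d) (hS : IsInvariant S) {s : ℕ}
    (hs : Module.finrank ℝ (tangentReal S) ≤ s) :
    μH[s] {T : Gr d n | IsInvariant T.1 ∧ ‖T.1.starProjection - S.starProjection‖ ≤ 1 / 2} < ∞ := by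
  obtain ⟨K, hK⟩ := exists_dist_chart_le h
  refine (measure_mono ?_).trans_lt (hausdorffMeasure_image_lt_top hK hs 2)
  rintro T ⟨hT, hTS⟩
  exact exists_chart_eq h hS hT hTS

theorem hausdorffMeasure_near_ne_zero (h : Module.finrank ℂ S = d) (hS : IsInvariant S) {δ : ℝ}
    (hδ : 0 < δ) : μH[Module.finrank ℝ (tangentReal S)]
      {T : Gr d n | IsInvariant T.1 ∧ ‖T.1.starProjection - S.starProjection‖ < δ} ≠ 0 := by
  obtain ⟨K, hK⟩ := exists_norm_le_dist_chart h
  -- Radius at most `1` for the inverse estimate, and at most `δ / 2` because the projector moves by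
  -- at most `2‖x‖`.
  have hpos := hausdorffMeasure_image_ne_zero (c := chart h) (K := K) (r := min 1 (δ / 2))
    (by positivity) (fun x y hx hy => hK x y (lt_min_iff.1 hx).1.le (lt_min_iff.1 hy).1.le)
  refine fun h0 => hpos (measure_mono_null ?_ h0)
  rintro _ ⟨x, hx, rfl⟩
  refine ⟨chart_isInvariant h hS _, ?_⟩
  have h0 : IsTangent S (0 : Bip n →L[ℂ] Bip n) :=
    ⟨fun v => Sᗮ.zero_mem, fun v _ => rfl⟩
  have h1 := (tangentReal_isTangent x).norm_starProjection_shear_sub_le h0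
  have h2 : shear S (0 : Bip n →L[ℂ] Bip n) = S := by
    ext v
    simp [mem_shear]
  rw [h2, sub_zero] at h1
  refine h1.trans_lt ?_
  have h3 : ‖(x : Bip n →L[ℂ] Bip n)‖ < δ / 2 := (lt_min_iff.1 hx).2
  linarith

end Chart

theorem hausdorffMeasure_invariant_lt_top {s : ℕ}
    (hs : ∀ S : Gr d n, IsInvariant S.1 → Module.finrank ℝ (tangentReal S.1) ≤ s) :
    μH[s] {T : Gr d n | IsInvariant T.1} < ∞ := by
  obtain ⟨K, hK⟩ := exists_norm_le_dist d n
  -- The centres are themselves invariant, so each carries a chart. The radius makes operator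
  -- distances at most `1/2`; `K + 1` guards against `K = 0`.
  obtain ⟨t, htA, htf, hcov⟩ := Metric.finite_approx_of_totallyBounded
    (totallyBounded_gr {T : Gr d n | IsInvariant T.1}) (1 / (2 * (K + 1))) (by positivity)
  refine (measure_mono (t := ⋃ S ∈ t, {T : Gr d n | IsInvariant T.1 ∧
    ‖T.1.starProjection - S.1.starProjection‖ ≤ 1 / 2}) ?_).trans_lt
    (measure_biUnion_lt_top htf fun S hS =>
      hausdorffMeasure_near_lt_top S.2 (htA hS) (hs S (htA hS)))
  intro T hT
  obtain ⟨S, hS, hTS⟩ := Set.mem_iUnion₂.1 (hcov hT)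
  refine Set.mem_iUnion₂.2 ⟨S, hS, hT, (hK T S).trans ?_⟩
  rw [Metric.mem_ball, lt_div_iff₀ (by positivity)] at hTS
  nlinarith [dist_nonneg (x := T) (y := S), K.2]

end FlipSubspace

/-! ### Positive definite matrices near the base point, and the conclusion. -/

namespace FlipSubspace

open scoped Kronecker ComplexOrder Matrix NNReal ENNReal
open MeasureTheory

variable {d n : ℕ}

/-- The number `x* (M - 1) x` is the Hilbert–Schmidt product of `x x*` with `M - 1`, and `x x*` has
norm `‖x‖²`; so it cannot cancel `x* x`. -/
theorem posDef_of_norm_sub_one_lt {M : Matrix (Fin n) (Fin n) ℂ} (hM : M.IsHermitian)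
    (h : ‖ofMat (M - 1)‖ < 1) : M.PosDef := by
  refine Matrix.PosDef.of_dotProduct_mulVec_pos hM fun x hx => ?_
  set r : ℝ := ∑ i, ‖x i‖ ^ 2 with hr
  have hrpos : 0 < r := by
    obtain ⟨i, hi⟩ := Function.ne_iff.1 hx
    exact Finset.sum_pos' (fun _ _ => by positivity)
      ⟨i, Finset.mem_univ i, pow_pos (norm_pos_iff.2 hi) 2⟩
  have hxx : star x ⬝ᵥ x = (r : ℂ) := by
    rw [hr, dotProduct, Complex.ofReal_sum]
    refine Finset.sum_congr rfl fun i _ => ?_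
    rw [Pi.star_apply, RCLike.star_def, Complex.conj_mul', Complex.ofReal_pow]
  have hnorm : ‖ofMat (Matrix.vecMulVec x (star x))‖ = r := by
    rw [← sq_eq_sq₀ (norm_nonneg _) hrpos.le, EuclideanSpace.norm_sq_eq, Fintype.sum_prod_type,
      pow_two, hr, Finset.sum_mul_sum]
    refine Finset.sum_congr rfl fun i _ => Finset.sum_congr rfl fun j _ => ?_
    simp [ofMat, Matrix.vecMulVec_apply, mul_pow]
  have hinner : inner ℂ (ofMat (Matrix.vecMulVec x (star x))) (ofMat (M - 1)) =
      star x ⬝ᵥ ((M - 1) *ᵥ x) := by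
    rw [inner_eq_trace, matForm_ofMat, matForm_ofMat, Matrix.conjTranspose_vecMulVec, star_star,
      Matrix.trace_mul_comm, Matrix.mul_vecMulVec, Matrix.trace_vecMulVec, dotProduct_comm]
  have hdec : star x ⬝ᵥ (M *ᵥ x) = (r : ℂ) + star x ⬝ᵥ ((M - 1) *ᵥ x) := by
    rw [Matrix.sub_mulVec, dotProduct_sub, Matrix.one_mulVec, hxx]
    ring
  have hbound : ‖star x ⬝ᵥ ((M - 1) *ᵥ x)‖ < r := by
    rw [← hinner]
    refine (norm_inner_le_norm _ _).trans_lt ?_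
    rw [hnorm]
    nlinarith
  rw [Complex.lt_def]
  refine ⟨?_, (hM.im_star_dotProduct_mulVec_self x).symm⟩
  rw [hdec, Complex.zero_re, Complex.add_re, Complex.ofReal_re]
  have := (abs_le.1 (Complex.abs_re_le_norm (star x ⬝ᵥ ((M - 1) *ᵥ x)))).1
  linarith

/-- The witnesses are the projection of the identity to `T` and `1 ⊗ X` applied to the projection of
`X` to `Tᗮ`. Both are Hermitian by invariance and close to the identity. -/
theorem exists_near_mem_PDef {S : Submodule ℂ (Bip n)} (h1 : ofMat 1 ∈ S)
    (hX : ofMat (antiDiag n) ∈ Sᗮ) : ∃ δ > 0, ∀ T : Gr d n, IsInvariant T.1 →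
      ‖T.1.starProjection - S.starProjection‖ < δ → T ∈ PDef d n := by
  let B := LinearMap.toContinuousLinearMap (tensorOp 1 (antiDiag n))
  set a := ‖(ofMat 1 : Bip n)‖ with ha
  set b := ‖B‖ * ‖(ofMat (antiDiag n) : Bip n)‖ with hb
  have ha0 : 0 ≤ a := norm_nonneg _
  have hb0 : 0 ≤ b := by positivity
  refine ⟨1 / (1 + a + b), by positivity, fun T hT hTS => ?_⟩
  rw [lt_div_iff₀ (by positivity)] at hTS
  set D := T.1.starProjection - S.starProjection with hD
  have hDa : ‖D‖ * a < 1 := by nlinarith [norm_nonneg D]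
  have hDb : ‖D‖ * b < 1 := by nlinarith [norm_nonneg D]
  have hfI : flip n (ofMat 1) = ofMat 1 := matForm_injective (by simp)
  have hfX : flip n (ofMat (antiDiag n)) = ofMat (antiDiag n) :=
    matForm_injective (by simp [antiDiag_conjTranspose])
  have hherm : ∀ v : Bip n, flip n v = v → (matForm n v).IsHermitian := fun v hv => by
    rw [Matrix.IsHermitian, ← matForm_flip, hv]
  set v := T.1.starProjection (ofMat 1) with hv
  set y := T.1ᗮ.starProjection (ofMat (antiDiag n)) with hy
  set u := tensorOp 1 (antiDiag n) y with hu
  have hvT : v ∈ T.1 := T.1.starProjection_apply_mem _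
  have hyT : y ∈ T.1ᗮ := T.1ᗮ.starProjection_apply_mem _
  refine ⟨mem_F_inter_C_iff.2 hT, matForm n v, Submodule.mem_map_of_mem hvT, matForm n u,
    Submodule.mem_map_of_mem (Submodule.mem_map_of_mem hyT), ?_, ?_⟩
  · refine posDef_of_norm_sub_one_lt (hherm v ?_) ?_
    · rw [hv, ← hT.starProjection_flip, hfI]
    · have e : ofMat (matForm n v - 1) = D (ofMat 1) := by
        refine matForm_injective ?_
        rw [hD, sub_apply, Submodule.starProjection_eq_self_iff.2 h1, map_sub]
        rfl
      rw [e]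
      exact (D.le_opNorm _).trans_lt hDa
  · refine posDef_of_norm_sub_one_lt (hherm u ?_) ?_
    -- Hermiticity of `y` is not enough: `y X` is Hermitian only if `y` commutes with `X`, which
    -- holds because `y` stays in the `+1` sector of `X ⊗ X`.
    · have hyf : flip n y = y := by rw [hy, ← hT.orthogonal.starProjection_flip, hfX]
      have hys : y ∈ sector n 0 := by
        rw [mem_sector, hy, ← hT.orthogonal.starProjection_sectorProj,
          mem_sector.1 ofMat_antiDiag_mem_sector]
      have h01 : mixedProj n y = 0 :=
        (sectorProj_apply_of_mem (i := 1) hys).trans (if_neg (by decide))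
      have h02 : mixedProj' n y = 0 :=
        (sectorProj_apply_of_mem (i := 2) hys).trans (if_neg (by decide))
      rw [hu, ← tensorOp_one_antiDiag_self (flip n _), tensorOp_flip_tensorOp, hyf,
        tensorOp_antiDiag_antiDiag, h01, h02, smul_zero, sub_zero, sub_zero]
    · have e : ofMat (matForm n u - 1) = B (-(D (ofMat (antiDiag n)))) := by
        refine matForm_injective ?_
        have hy2 : y = ofMat (antiDiag n) + -(D (ofMat (antiDiag n))) := by
          rw [hy, Submodule.starProjection_orthogonal_val, hD, sub_apply,
            (Submodule.starProjection_apply_eq_zero_iff _).2 hX, sub_zero, sub_eq_add_neg]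
        change matForm n u - 1 = matForm n (tensorOp 1 (antiDiag n) _)
        rw [hu, hy2, map_add, map_add, matForm_tensorOp, matForm_ofMat, antiDiag_transpose, one_mul,
          antiDiag_mul_self, add_sub_cancel_left]
      rw [e]
      refine ((B.le_opNorm _).trans ?_).trans_lt hDb
      rw [norm_neg, hb, mul_left_comm]
      gcongr
      exact D.le_opNorm _

theorem PDef_subset_P (hn : n ≠ 0) : PDef d n ⊆ P d n := by
  have : NeZero n := ⟨hn⟩
  have hne : ∀ {M : Matrix (Fin n) (Fin n) ℂ}, M.PosDef → M ≠ 0 := fun hM h0 => by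
    have := hM.diag_pos (i := (0 : Fin n))
    simp [h0] at this
  rintro S ⟨hS, M, hM, M', hM', h1, h2⟩
  exact ⟨hS, M, hM, M', hM', hne h1, hne h2, h1.posSemidef, h2.posSemidef⟩

/-- A set that is large in some dimension in which the ambient set is finite has positive
normalised volume. -/
theorem normalizedVolume_ne_zero {Y : Type*} [MetricSpace Y] [MeasurableSpace Y] [BorelSpace Y]
    {A B : Set Y} (hBA : B ⊆ A) {s : ℕ} (hA : μH[s] A ≠ ∞) (hB : μH[s] B ≠ 0) :
    normalizedVolume A B ≠ 0 := by
  -- Finite `s`-measure of `A` bounds the dimension above, and positive `s`-measure of `B` bounds it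
  -- below.
  have hdim : (dimH A).toReal = s := by
    have h1 : dimH A ≤ ((s : ℝ≥0) : ℝ≥0∞) :=
      dimH_le_of_hausdorffMeasure_ne_top (by simpa using hA)
    have h2 : ((s : ℝ≥0) : ℝ≥0∞) ≤ dimH A :=
      (le_dimH_of_hausdorffMeasure_ne_zero (by simpa using hB)).trans (dimH_mono hBA)
    rw [le_antisymm h1 h2]
    simp
  rw [normalizedVolume, hdim, ProbabilityTheory.cond, Measure.smul_apply, smul_eq_mul]
  refine mul_ne_zero (ENNReal.inv_ne_zero.2 hA) fun h0 => hB ?_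
  -- This inequality for the restricted measure needs no measurability of `A` or `B`.
  have := Measure.le_restrict_apply (μ := μH[s]) A B
  rw [h0, Set.inter_eq_left.2 hBA] at this
  exact le_antisymm this (zero_le)

theorem normalizedVolume_PDef_ne_zero (hn : Even n) (hd : 1 ≤ d) (h : d / 2 + 2 ≤ n ^ 2 / 2) :
    normalizedVolume (F d n ∩ C d n) (PDef d n) ≠ 0 := by
  have h4 := four_mul_finrank_sector hn
  have h5 := finrank_sector_zero (n := n)
  set e := Module.finrank ℂ (sector n 1) with he
  have h0 : Module.finrank ℂ (sector n 0) = 2 * e := by omega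
  have hn0 : n ≠ 0 := by
    rintro rfl
    omega
  obtain ⟨k, m, hkm, hk1, hk2, hm, hmax⟩ := exists_optimal_dimensions (e := e) hd (by omega)
  obtain ⟨S, hS, hSk, hSm, hSI, hSX⟩ := exists_invariant hn hn0 hk1 (by rw [h0]; exact hk2) hm
  have hfin : ∀ T : Submodule ℂ (Bip n), IsInvariant T → Module.finrank ℝ (tangentReal T) =
      Module.finrank ℂ ↥(T ⊓ sector n 0) * (2 * e - Module.finrank ℂ ↥(T ⊓ sector n 0)) +
      2 * (Module.finrank ℂ ↥(T ⊓ sector n 1) * (e - Module.finrank ℂ ↥(T ⊓ sector n 1))) := by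
    intro T hT
    have e0 := hT.finrank_inf_sector_add 0
    have e1 := hT.finrank_inf_sector_add 1
    rw [hT.finrank_tangentReal, ← h0, ← e0, he, ← e1, Nat.add_sub_cancel_left,
      Nat.add_sub_cancel_left]
  have hsum : ∀ T : Submodule ℂ (Bip n), IsInvariant T → Module.finrank ℂ ↥(T ⊓ sector n 0) +
      2 * Module.finrank ℂ ↥(T ⊓ sector n 1) = Module.finrank ℂ T := by
    intro T hT
    have := hT.sum_finrank_inf_sector
    rw [Fin.sum_univ_three, hT.finrank_inf_sector_two] at this
    omega
  have hSd : Module.finrank ℂ S = d := by rw [← hsum S hS, hSk, hSm, hkm]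
  have hset : F d n ∩ C d n = {T : Gr d n | IsInvariant T.1} := by
    ext T
    exact mem_F_inter_C_iff
  obtain ⟨δ, hδ, hnear⟩ := exists_near_mem_PDef (d := d) hSI hSX
  refine normalizedVolume_ne_zero (s := Module.finrank ℝ (tangentReal S)) (fun T hT => hT.1) ?_ ?_
  · rw [hset]
    refine (hausdorffMeasure_invariant_lt_top fun T hT => ?_).ne
    rw [hfin _ hT, hfin S hS, hSk, hSm]
    -- Maximality of the piece of `S` bounds every other tangent dimension, so the total measure is
    -- finite in the dimension in which the neighbourhood of `S` is positive.
    refine hmax _ _ ((hsum _ hT).trans T.2) ?_ ?_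
    · have := hT.finrank_inf_sector_add 0
      omega
    · have := hT.finrank_inf_sector_add 1
      omega
  · exact fun hz => hausdorffMeasure_near_ne_zero hSd hS hδ
      (measure_mono_null (fun T hT => hnear T hT.1 hT.2) hz)

end FlipSubspace

theorem mainTheorem6 (dA d : ℕ) (hdA : Even dA) (hd : 1 ≤ d)
    (hdim : ((d / 2 : ℕ) : ℝ) ≤ (dA : ℝ) ^ 2 / 2 - 2) :
    FlipSubspace.normalizedVolume (FlipSubspace.F d dA ∩ FlipSubspace.C d dA)
        (FlipSubspace.P d dA) ≠ 0 ∧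
      FlipSubspace.normalizedVolume (FlipSubspace.F d dA ∩ FlipSubspace.C d dA)
        (FlipSubspace.PDef d dA) ≠ 0 := by
  have h : d / 2 + 2 ≤ dA ^ 2 / 2 := by
    -- Clearing the truncated division turns the goal into the doubled real hypothesis.
    rw [Nat.le_div_iff_mul_le two_pos]
    have h1 : (((d / 2 + 2) * 2 : ℕ) : ℝ) ≤ ((dA ^ 2 : ℕ) : ℝ) := by
      push_cast at hdim ⊢
      linarith
    exact_mod_cast h1
  have hn : dA ≠ 0 := by
    rintro rfl
    omega
  have hP := FlipSubspace.normalizedVolume_PDef_ne_zero hdA hd h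
  exact ⟨fun h0 => hP (MeasureTheory.measure_mono_null (FlipSubspace.PDef_subset_P hn) h0), hP⟩
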